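/- **Theorem 2.1.** For a locally absolutely continuous function $\varphi:[1,\infty)\to\mathbb R$ and $\beta>0$ put $$I(\varphi)=I_\beta(\varphi)=\int_1^\infty\Big(x^4(\varphi')^2+\frac{\beta x^2}{4}(\varphi^2-1)^2\Big)\,dx\in[0,\infty].$$ For every $\beta>0$ the two-point boundary value problem $$(x^4\varphi')'=\frac{\beta x^2}{2}\,\varphi(\varphi^2-1)\quad (1<x<\infty),\qquad \varphi(1)=0,\qquad \varphi(\infty):=\lim_{x\to\infty}\varphi(x)=1,$$ has a unique solution $\varphi$ (continuous on $[1,\infty)$ and twice differentiable on $(1,\infty)$). There is a number $a_0>0$ such that $\varphi$ solves the initial value problem for the same equation with $\varphi(1)=0$, $\varphi'(1)=a_0$, and a solution on $[1,\infty)$ of the initial value problem with $\varphi(1)=0$, $\varphi'(1)=a$ tends to $1$ at infinity if and only if $a=a_0$. The solution $\varphi$ has the following properties. (i) $\varphi$ is strictly increasing on $[1,\infty)$ and $0<\varphi(x)<1$ for $x>1$. (ii) $\varphi(x)=a_0(x-1)+O((x-1)^2)$ as $x\to1^+$, and, with $\lambda_0=\frac32+\sqrt{\left(\frac32\right)^2+\beta}$,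 for every $\varepsilon>0$, $$1-\varphi(x)=O\big(x^{-(\lambda_0-\varepsilon)}\big)\quad\text{as }x\to\infty.$$ (iii) $I(\varphi)<\infty$, and $\varphi$ minimizes $I$ among all locally absolutely continuous functions on $[1,\infty)$ with value $0$ at $x=1$ and limit $1$ at infinity. (iv) Let $f(\beta)=I_\beta(\varphi)$ be this minimum, and let $$\sigma(\beta)=4\int_1^\infty y^{\frac{3}{\sqrt\beta}-1}\,\frac{3y+1}{(y+1)^3}\,dy .$$ Then, for all $\beta>\frac94$, $$\frac{2\sqrt\beta}{3}<f(\beta)<\sigma(\beta)+\frac{2\sqrt\beta}{3},\qquad 1+\frac{3}{2\sqrt\beta-3}<\sigma(\beta)<6+\frac{18}{2\sqrt\beta-3}.$$ In particular, $f(\beta)\sim\frac{2\sqrt\beta}{3}$ as $\beta\to\infty$, i.e. $f(\beta)\big/\tfrac{2\sqrt\beta}{3}\to1$. -/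

import Mathlib

open Set Filter Topology MeasureTheory Asymptotics
open scoped ENNReal

namespace MonopoleWall

/-- `φ` is twice differentiable on `(1, ∞)` in the sense that `φ` and `x ⁴ φ'` are
differentiable there, and `(x ⁴ φ')' = (β x ² / 2) φ (φ ² - 1)` on `(1, ∞)`. -/
def SolvesODE (β : ℝ) (φ : ℝ → ℝ) : Prop :=
  ∀ x : ℝ, 1 < x → DifferentiableAt ℝ φ x ∧
    HasDerivAt (fun y : ℝ => y ^ 4 * deriv φ y)
      (β * x ^ 2 / 2 * (φ x * (φ x ^ 2 - 1))) x

/-- The boundary conditions `φ(1) = 0` and `φ(∞) = 1`. -/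
def BoundaryConditions (φ : ℝ → ℝ) : Prop :=
  φ 1 = 0 ∧ Tendsto φ atTop (𝓝 1)

/-- Classical solution of the two-point boundary value problem on `[1, ∞)`. Only the values of
`φ` on `[1, ∞)` matter. -/
structure IsBVPSolution (β : ℝ) (φ : ℝ → ℝ) : Prop where
  continuousOn : ContinuousOn φ (Ici 1)
  boundary : BoundaryConditions φ
  ode : SolvesODE β φ

/-- Global solution on `[1, ∞)` of the initial value problem with `φ(1) = 0`, `φ'(1) = a`
(the derivative at the end point `1` being one-sided). -/
structure IsIVPSolution (β a : ℝ) (φ : ℝ → ℝ) : Prop where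
  initial : φ 1 = 0
  slope : HasDerivWithinAt φ a (Ici 1) 1
  ode : SolvesODE β φ

/-- The energy `∫₁^∞ (x ⁴ φ' ² + (β x ² / 4) (φ ² - 1) ²) dx`, with values in `[0, ∞]`; for
`0 ≤ β` the integrand is nonnegative. -/
noncomputable def energy (β : ℝ) (φ : ℝ → ℝ) : ℝ≥0∞ :=
  ∫⁻ x in Ioi (1 : ℝ),
    ENNReal.ofReal (x ^ 4 * deriv φ x ^ 2 + β * x ^ 2 / 4 * (φ x ^ 2 - 1) ^ 2)

/-- The competitors in the minimization problem: locally absolutely continuous functions on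
`[1, ∞)` (so that `φ'` exists almost everywhere and is the weak derivative) that satisfy the
boundary conditions. The energy of a competitor may be infinite. -/
def Admissible (φ : ℝ → ℝ) : Prop :=
  (∀ b : ℝ, 1 < b → AbsolutelyContinuousOnInterval φ 1 b) ∧ BoundaryConditions φ

/-- The minimum energy `f(β)`, as the infimum of the energies of the competitors. -/
noncomputable def minEnergy (β : ℝ) : ℝ :=
  (⨅ (φ : ℝ → ℝ) (_ : Admissible φ), energy β φ).toReal

/-- The function `σ(β) = 4 ∫₁^∞ y ^ (3 / √β - 1) (3 y + 1) / (y + 1) ³ dy`. -/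
noncomputable def sigma (β : ℝ) : ℝ :=
  4 * ∫ y in Ioi (1 : ℝ), y ^ (3 / √β - 1) * ((3 * y + 1) / (y + 1) ^ 3)

end MonopoleWall

/-! In the variable `t = log x` the equation becomes `u'' + 3 u' = -(β / 2) u (1 - u ^ 2)`: a
particle with friction that must come to rest at `1`, a maximum of its potential. The quantity `u' ^
2 - (β / 4) (1 - u ^ 2) ^ 2` decreases along trajectories and cannot be negative on one that tends
to `1`. Backward uniqueness makes it positive, so `u'` never vanishes, `u` increases, and `u' > (√β
/ 2) (1 - u ^ 2)` (`IsKink.excess_pos`, `IsKink.lt_velocity`).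

Existence is by monotone iteration. After subtracting `β (β + 3) u`, the linear part factors as `(D
+ β + 3) (D - β)` and the remaining right side is monotone in `u`. Iterating down from `1`, above
the subsolution `tanh (√β t / 2)`, yields a kink that dominates all others (`exists_maximal_kink`).
For two ordered kinks a weighted Wronskian shows that their ratio is monotone; its limit `1` forces
them to agree (`IsKink.eqOn_of_le`). Together with uniqueness for the initial value problem this
gives the shooting statement. The decay rate comes from comparison with the linearization at `1`,
for which `l (l - 3) = β`.

Minimality rests on a Picone identity: up to the derivative of `piconeFlux`, the energy density of a
competitor `ψ` exceeds that of `φ` by `(β x ^ 2 / 4) (φ ^ 2 - ψ ^ 2) ^ 2` plus a square. The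
boundary terms disappear in the limit, at `1` because `ψ ^ 2 = o(x - 1)` and at infinity because the
flux `x ^ 4 φ'` is bounded (`IsBVPSolution.lintegral_le_energy`).

For the bounds, completing the square gives density `≥ x ^ 3 √β φ' (1 - φ ^ 2)`. Dropping `x ^ 3 >
1` leaves an exact derivative with integral `2 √β / 3`. The tanh profile makes the square vanish,
and integrating its energy by parts produces `sigma β + 2 √β / 3`. -/

namespace MonopoleWall

/-- `u` solves the autonomous equation `u'' + 3 u' + (β / 2) u (1 - u ²) = 0` on `(0, ∞)`, with
derivative `v`; this is the wall equation in the variable `t = log x`. -/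
structure IsTrajectory (β : ℝ) (u v : ℝ → ℝ) : Prop where
  hasDerivAt_fst : ∀ t, 0 < t → HasDerivAt u (v t) t
  hasDerivAt_snd : ∀ t, 0 < t → HasDerivAt v (-(3 * v t) - β / 2 * (u t * (1 - u t ^ 2))) t

/-- The vector field of the autonomous system. -/
noncomputable def wallField (β : ℝ) (p : ℝ × ℝ) : ℝ × ℝ :=
  (p.2, -(3 * p.2) - β / 2 * (p.1 * (1 - p.1 ^ 2)))

lemma contDiff_wallField (β : ℝ) : ContDiff ℝ 1 (wallField β) := by
  unfold wallField
  fun_prop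

lemma exists_lipschitzOnWith_wallField (β R : ℝ) :
    ∃ K, LipschitzOnWith K (wallField β) (Metric.closedBall 0 R) :=
  (contDiff_wallField β).contDiffOn.exists_lipschitzOnWith (by decide) (convex_closedBall _ _)
    (isCompact_closedBall _ _)

/-! ### Uniqueness, initial velocity and dissipation for the autonomous system. -/

namespace IsTrajectory

variable {β : ℝ} {u v u₁ v₁ u₂ v₂ : ℝ → ℝ}

lemma congr_snd (h : IsTrajectory β u v) {w : ℝ → ℝ} (hw : ∀ t, 0 < t → w t = v t) :
    IsTrajectory β u w where
  hasDerivAt_fst t ht := by rw [hw t ht]; exact h.hasDerivAt_fst t ht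
  hasDerivAt_snd t ht := by
    rw [hw t ht]
    exact (h.hasDerivAt_snd t ht).congr_of_eventuallyEq
      (by filter_upwards [Ioi_mem_nhds ht] with s hs using hw s hs)

lemma continuousOn_fst (h : IsTrajectory β u v) : ContinuousOn u (Ioi 0) := fun t ht =>
  (h.hasDerivAt_fst t ht).continuousAt.continuousWithinAt

lemma continuousOn_snd (h : IsTrajectory β u v) : ContinuousOn v (Ioi 0) := fun t ht =>
  (h.hasDerivAt_snd t ht).continuousAt.continuousWithinAt

lemma hasDerivAt_prodMk (h : IsTrajectory β u v) {t : ℝ} (ht : 0 < t) :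
    HasDerivAt (fun s => (u s, v s)) (wallField β (u t, v t)) t :=
  (h.hasDerivAt_fst t ht).prodMk (h.hasDerivAt_snd t ht)

/-- Backward uniqueness. -/
lemma eqOn_Ioc (h₁ : IsTrajectory β u₁ v₁) (h₂ : IsTrajectory β u₂ v₂) {b : ℝ}
    (hu : u₁ b = u₂ b) (hv : v₁ b = v₂ b) : EqOn u₁ u₂ (Ioc 0 b) := by
  intro a ha
  have hsub : Icc a b ⊆ Ioi 0 := fun t ht => ha.1.trans_le ht.1
  have c₁ : ContinuousOn (fun s => (u₁ s, v₁ s)) (Icc a b) :=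
    (h₁.continuousOn_fst.prodMk h₁.continuousOn_snd).mono hsub
  have c₂ : ContinuousOn (fun s => (u₂ s, v₂ s)) (Icc a b) :=
    (h₂.continuousOn_fst.prodMk h₂.continuousOn_snd).mono hsub
  obtain ⟨R₁, hR₁⟩ := isCompact_Icc.exists_bound_of_continuousOn c₁
  obtain ⟨R₂, hR₂⟩ := isCompact_Icc.exists_bound_of_continuousOn c₂
  -- The cubic field is only locally Lipschitz; both compact arcs lie in one ball, where a single
  -- constant serves.
  obtain ⟨K, hK⟩ := exists_lipschitzOnWith_wallField β (max R₁ R₂)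
  have key := ODE_solution_unique_of_mem_Icc_left (v := fun _ => wallField β)
    (s := fun _ => Metric.closedBall 0 (max R₁ R₂)) (fun _ _ => hK) c₁
    (fun t ht => (h₁.hasDerivAt_prodMk (ha.1.trans ht.1)).hasDerivWithinAt)
    (fun t ht => by
      simpa using! (hR₁ t (Ioc_subset_Icc_self ht)).trans (le_max_left R₁ R₂)) c₂
    (fun t ht => (h₂.hasDerivAt_prodMk (ha.1.trans ht.1)).hasDerivWithinAt)
    (fun t ht => by
      simpa using! (hR₂ t (Ioc_subset_Icc_self ht)).trans (le_max_right R₁ R₂))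
    (by simp [hu, hv])
  exact congrArg Prod.fst (key (left_mem_Icc.2 ha.2))

/-- A trajectory that is continuous up to the initial time has a velocity there. -/
lemma exists_tendsto_snd (h : IsTrajectory β u v) (hu : ContinuousOn u (Ici 0)) :
    ∃ c, Tendsto v (𝓝[>] 0) (𝓝 c) := by
  have hc : ContinuousOn (fun t => -(Real.exp (3 * t) * (β / 2 * (u t * (1 - u t ^ 2)))))
      (Icc 0 1) := by
    have := hu.mono (Icc_subset_Ici_self : Icc (0 : ℝ) 1 ⊆ _)
    fun_prop
  obtain ⟨C, hC⟩ := isCompact_Icc.exists_bound_of_continuousOn hc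
  have hd : ∀ t, 0 < t → HasDerivAt (fun t => Real.exp (3 * t) * v t)
      (-(Real.exp (3 * t) * (β / 2 * (u t * (1 - u t ^ 2))))) t := by
    intro t ht
    have h1 : HasDerivAt (fun t : ℝ => Real.exp (3 * t)) (Real.exp (3 * t) * (3 * 1)) t :=
      ((hasDerivAt_id t).const_mul 3).exp
    exact (h1.mul (h.hasDerivAt_snd t ht)).congr_deriv (by ring)
  -- The integrating factor removes the friction term, so the derivative is bounded near `0`. A
  -- Lipschitz function on `(0, 1)` extends continuously to the end point.
  have hlip : LipschitzOnWith C.toNNReal (fun t => Real.exp (3 * t) * v t) (Ioo 0 1) :=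
    (convex_Ioo 0 1).lipschitzOnWith_of_nnnorm_hasDerivWithin_le
      (fun t ht => (hd t ht.1).hasDerivWithinAt) (fun t ht => by
        rw [← NNReal.coe_le_coe, coe_nnnorm]
        exact (hC t (Ioo_subset_Icc_self ht)).trans (Real.le_coe_toNNReal C))
  obtain ⟨g, hg, hgv⟩ := hlip.extend_real
  have hlim : Tendsto (fun t => Real.exp (-(3 * t)) * g t) (𝓝[>] 0)
      (𝓝 (Real.exp (-(3 * 0)) * g 0)) := by
    have := hg.continuous
    exact ((by fun_prop : Continuous fun t => Real.exp (-(3 * t)) * g t).tendsto 0).mono_left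
      nhdsWithin_le_nhds
  refine ⟨_, hlim.congr' ?_⟩
  filter_upwards [Ioo_mem_nhdsGT (zero_lt_one' ℝ)] with t ht
  rw [← hgv ht, ← mul_assoc, ← Real.exp_add]
  simp

lemma hasDerivWithinAt_zero (h : IsTrajectory β u v) (hu : ContinuousOn u (Ici 0)) {c : ℝ}
    (hv : Tendsto v (𝓝[>] 0) (𝓝 c)) : HasDerivWithinAt u c (Ici 0) 0 := by
  refine hasDerivWithinAt_Ici_of_tendsto_deriv (s := Ioi 0)
    (fun t ht => (h.hasDerivAt_fst t ht).differentiableAt.differentiableWithinAt)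
    ((hu 0 self_mem_Ici).mono Ioi_subset_Ici_self) self_mem_nhdsWithin (hv.congr' ?_)
  filter_upwards [self_mem_nhdsWithin] with t ht using (h.hasDerivAt_fst t ht).deriv.symm

/-- The trajectory, with its velocity extended continuously, as an integral curve on `[0, ∞)`. -/
lemma exists_hasDerivWithinAt (h : IsTrajectory β u v) (hu : ContinuousOn u (Ici 0)) {c : ℝ}
    (hv : Tendsto v (𝓝[>] 0) (𝓝 c)) :
    ∃ w : ℝ → ℝ, w 0 = c ∧ ContinuousOn w (Ici 0) ∧
      ∀ t, 0 ≤ t → HasDerivWithinAt (fun s => (u s, w s)) (wallField β (u t, w t)) (Ici t) t := by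
  -- The value `v 0` is arbitrary; only the right limit at `0` carries information.
  set w : ℝ → ℝ := fun t => if 0 < t then v t else c with hw
  have hwv : ∀ t, 0 < t → w t = v t := fun t ht => by simp [hw, ht]
  have hw0 : w 0 = c := by simp [hw]
  have hT := h.congr_snd hwv
  have hlim : Tendsto w (𝓝[>] 0) (𝓝 c) := hv.congr' (by
    filter_upwards [self_mem_nhdsWithin] with t ht using (hwv t ht).symm)
  have hwc0 : ContinuousWithinAt w (Ioi 0) 0 := by
    rw [ContinuousWithinAt, hw0]; exact hlim
  have hul : Tendsto u (𝓝[>] 0) (𝓝 (u 0)) :=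
    (hu 0 self_mem_Ici).mono_left (nhdsWithin_mono _ Ioi_subset_Ici_self)
  have hw' : HasDerivWithinAt w (-(3 * c) - β / 2 * (u 0 * (1 - u 0 ^ 2))) (Ici 0) 0 := by
    refine hasDerivWithinAt_Ici_of_tendsto_deriv (s := Ioi 0)
      (fun t ht => (hT.hasDerivAt_snd t ht).differentiableAt.differentiableWithinAt)
      hwc0 self_mem_nhdsWithin ?_
    have : Tendsto (fun t => -(3 * w t) - β / 2 * (u t * (1 - u t ^ 2))) (𝓝[>] 0)
        (𝓝 (-(3 * c) - β / 2 * (u 0 * (1 - u 0 ^ 2)))) :=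
      (hlim.const_mul 3).neg.sub ((hul.mul ((hul.pow 2).const_sub 1)).const_mul _)
    refine this.congr' ?_
    filter_upwards [self_mem_nhdsWithin] with t ht using (hT.hasDerivAt_snd t ht).deriv.symm
  refine ⟨w, hw0, fun t ht => ?_, fun t ht => ?_⟩
  · rcases (mem_Ici.1 ht).eq_or_lt with rfl | ht
    · exact hw'.continuousWithinAt
    · exact (hT.hasDerivAt_snd t ht).continuousAt.continuousWithinAt
  · rcases ht.eq_or_lt with rfl | ht
    · simp only [wallField, hw0]
      exact (h.hasDerivWithinAt_zero hu hv).prodMk hw'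
    · exact (hT.hasDerivAt_prodMk ht).hasDerivWithinAt

/-- Uniqueness for the initial value problem at `t = 0`. -/
lemma eqOn_Ici (h₁ : IsTrajectory β u₁ v₁) (h₂ : IsTrajectory β u₂ v₂)
    (hu₁ : ContinuousOn u₁ (Ici 0)) (hu₂ : ContinuousOn u₂ (Ici 0)) {c : ℝ}
    (hv₁ : Tendsto v₁ (𝓝[>] 0) (𝓝 c)) (hv₂ : Tendsto v₂ (𝓝[>] 0) (𝓝 c)) (h0 : u₁ 0 = u₂ 0) :
    EqOn u₁ u₂ (Ici 0) := by
  intro b hb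
  obtain ⟨w₁, hw₁, hc₁, hd₁⟩ := h₁.exists_hasDerivWithinAt hu₁ hv₁
  obtain ⟨w₂, hw₂, hc₂, hd₂⟩ := h₂.exists_hasDerivWithinAt hu₂ hv₂
  have c₁ : ContinuousOn (fun s => (u₁ s, w₁ s)) (Icc 0 b) :=
    (hu₁.prodMk hc₁).mono Icc_subset_Ici_self
  have c₂ : ContinuousOn (fun s => (u₂ s, w₂ s)) (Icc 0 b) :=
    (hu₂.prodMk hc₂).mono Icc_subset_Ici_self
  obtain ⟨R₁, hR₁⟩ := isCompact_Icc.exists_bound_of_continuousOn c₁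
  obtain ⟨R₂, hR₂⟩ := isCompact_Icc.exists_bound_of_continuousOn c₂
  obtain ⟨K, hK⟩ := exists_lipschitzOnWith_wallField β (max R₁ R₂)
  have key := ODE_solution_unique_of_mem_Icc_right (v := fun _ => wallField β)
    (s := fun _ => Metric.closedBall 0 (max R₁ R₂)) (fun _ _ => hK) c₁
    (fun t ht => hd₁ t ht.1)
    (fun t ht => by
      simpa using! (hR₁ t (Ico_subset_Icc_self ht)).trans (le_max_left R₁ R₂)) c₂
    (fun t ht => hd₂ t ht.1)
    (fun t ht => by
      simpa using! (hR₂ t (Ico_subset_Icc_self ht)).trans (le_max_right R₁ R₂))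
    (by simp [h0, hw₁, hw₂])
  exact congrArg Prod.fst (key (right_mem_Icc.2 hb))

lemma hasDerivAt_excess (h : IsTrajectory β u v) {t : ℝ} (ht : 0 < t) :
    HasDerivAt (fun s => v s ^ 2 - β / 4 * (1 - u s ^ 2) ^ 2) (-(6 * v t ^ 2)) t := by
  have h1 := (h.hasDerivAt_snd t ht).fun_pow 2
  have h2 := ((((h.hasDerivAt_fst t ht).fun_pow 2).const_sub 1).fun_pow 2).const_mul (β / 4)
  exact (h1.sub h2).congr_deriv (by push_cast; ring)

/-- The mechanical energy, relative to that of the equilibrium `1`, is dissipated. -/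
lemma antitoneOn_excess (h : IsTrajectory β u v) :
    AntitoneOn (fun s => v s ^ 2 - β / 4 * (1 - u s ^ 2) ^ 2) (Ioi 0) := by
  refine antitoneOn_of_deriv_nonpos (convex_Ioi 0)
    (fun t ht => (h.hasDerivAt_excess ht).continuousAt.continuousWithinAt)
    (fun t ht => ?_) (fun t ht => ?_) <;> rw [interior_Ioi] at ht
  · exact (h.hasDerivAt_excess ht).differentiableAt.differentiableWithinAt
  · rw [(h.hasDerivAt_excess ht).deriv]
    nlinarith [sq_nonneg (v t)]

end IsTrajectory

/-- A trajectory that joins `0` at time `0` to the equilibrium `1` at infinity. -/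
structure IsKink (β : ℝ) (u v : ℝ → ℝ) : Prop extends IsTrajectory β u v where
  continuousOn : ContinuousOn u (Ici 0)
  map_zero : u 0 = 0
  tendsto : Tendsto u atTop (𝓝 1)

/-! ### Monotonicity and first-order bounds for kinks. -/

namespace IsKink

variable {β : ℝ} {u v : ℝ → ℝ}

lemma tendsto_well (h : IsKink β u v) :
    Tendsto (fun t => β / 4 * (1 - u t ^ 2) ^ 2) atTop (𝓝 0) := by
  have := (((h.tendsto.pow 2).const_sub 1).pow 2).const_mul (β / 4)
  simpa using this

/-- A negative value would bound the decreasing excess away from `0` from above, whereas the excess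
is at least `-(β / 4) (1 - u ^ 2) ^ 2`, which tends to `0`. -/
lemma excess_nonneg (h : IsKink β u v) {t : ℝ} (ht : 0 < t) :
    0 ≤ v t ^ 2 - β / 4 * (1 - u t ^ 2) ^ 2 := by
  have hlim := h.tendsto_well.neg
  rw [neg_zero] at hlim
  by_contra! hneg
  obtain ⟨s, hs, hts⟩ := ((hlim.eventually (lt_mem_nhds hneg)).and (eventually_ge_atTop t)).exists
  have := h.antitoneOn_excess ht (ht.trans_le hts) hts
  dsimp only at this
  nlinarith [sq_nonneg (v s)]

/-- If the excess vanishes once, it vanishes from then on, so dissipation stops: `v = 0` and `u = 1`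
at later times. Backward uniqueness against the constant trajectory `1` then contradicts `u 0 = 0`.
-/
lemma excess_pos (h : IsKink β u v) {t : ℝ} (ht : 0 < t) :
    0 < v t ^ 2 - β / 4 * (1 - u t ^ 2) ^ 2 := by
  refine (h.excess_nonneg ht).lt_of_ne fun h0 => ?_
  have hz : ∀ s, t ≤ s → v s ^ 2 - β / 4 * (1 - u s ^ 2) ^ 2 = 0 := fun s hs =>
    le_antisymm ((h.antitoneOn_excess ht (ht.trans_le hs) hs).trans h0.symm.le)
      (h.excess_nonneg (ht.trans_le hs))
  have hv : ∀ s, t < s → v s = 0 := by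
    intro s hs
    have h1 := (h.hasDerivAt_excess (ht.trans hs)).unique
      ((hasDerivAt_const s (0 : ℝ)).congr_of_eventuallyEq
        (by filter_upwards [Ioi_mem_nhds hs] with r hr using hz r (le_of_lt hr)))
    nlinarith
  have hu : ∀ s, t < s → u s = 1 := by
    intro s hs
    have hconst : ∀ r ∈ Ioi t, u r = u s := fun r hr => by
      refine (convex_Ioi t).is_const_of_fderivWithin_eq_zero (𝕜 := ℝ)
        (fun q hq => (h.hasDerivAt_fst q (ht.trans hq)).differentiableAt.differentiableWithinAt)
        (fun q hq => ?_) hr hs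
      have hq' := (h.hasDerivAt_fst q (ht.trans hq)).hasFDerivAt.hasFDerivWithinAt (s := Ioi t)
      rw [hq'.fderivWithin (isOpen_Ioi.uniqueDiffWithinAt hq), hv q hq]
      ext; simp
    refine tendsto_nhds_unique (tendsto_const_nhds.congr' ?_) h.tendsto
    filter_upwards [Ioi_mem_atTop t] with r hr using (hconst r hr).symm
  have hone : IsTrajectory β (fun _ => 1) (fun _ => 0) :=
    ⟨fun s _ => hasDerivAt_const _ _, fun s _ => by
      simpa using hasDerivAt_const s (0 : ℝ)⟩
  have heq := h.toIsTrajectory.eqOn_Ioc hone (hu (t + 1) (by linarith)) (hv (t + 1) (by linarith))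
  have hlim : Tendsto u (𝓝[>] 0) (𝓝 (u 0)) :=
    (h.continuousOn 0 self_mem_Ici).mono_left (nhdsWithin_mono _ Ioi_subset_Ici_self)
  have h1 : u 0 = 1 := by
    refine tendsto_nhds_unique hlim (tendsto_const_nhds.congr' ?_)
    filter_upwards [Ioc_mem_nhdsGT (show (0 : ℝ) < t + 1 by linarith)] with r hr
      using (heq hr).symm
  rw [h.map_zero] at h1
  exact zero_ne_one h1

/-- Positive excess excludes `v = 0`, so by Darboux `v` has one sign; a negative sign would keep `u`
below `0`. -/
lemma velocity_pos (hβ : 0 < β) (h : IsKink β u v) {t : ℝ} (ht : 0 < t) : 0 < v t := by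
  have hne : ∀ s ∈ Ioi (0 : ℝ), v s ≠ 0 := fun s hs h0 => by
    have := h.excess_pos hs
    rw [h0] at this
    nlinarith [sq_nonneg (1 - u s ^ 2), mul_nonneg hβ.le (sq_nonneg (1 - u s ^ 2))]
  rcases hasDerivWithinAt_forall_lt_or_forall_gt_of_forall_ne (convex_Ioi 0)
    (fun s hs => (h.hasDerivAt_fst s hs).hasDerivWithinAt) hne with hlt | hgt
  · have hanti : StrictAntiOn u (Ici 0) := by
      refine strictAntiOn_of_deriv_neg (convex_Ici 0) h.continuousOn fun s hs => ?_
      rw [interior_Ici] at hs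
      rw [(h.hasDerivAt_fst s hs).deriv]
      exact hlt s hs
    have hle : (1 : ℝ) ≤ 0 := le_of_tendsto h.tendsto (by
      filter_upwards [eventually_ge_atTop 0] with s hs
      rw [← h.map_zero]
      exact hanti.antitoneOn self_mem_Ici hs hs)
    linarith
  · exact hgt t ht

lemma strictMonoOn (hβ : 0 < β) (h : IsKink β u v) : StrictMonoOn u (Ici 0) := by
  refine strictMonoOn_of_deriv_pos (convex_Ici 0) h.continuousOn fun s hs => ?_
  rw [interior_Ici] at hs
  rw [(h.hasDerivAt_fst s hs).deriv]
  exact h.velocity_pos hβ hs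

lemma pos (hβ : 0 < β) (h : IsKink β u v) {t : ℝ} (ht : 0 < t) : 0 < u t := by
  have := h.strictMonoOn hβ self_mem_Ici (mem_Ici.2 ht.le) ht
  rwa [h.map_zero] at this

lemma lt_one (hβ : 0 < β) (h : IsKink β u v) {t : ℝ} (ht : 0 ≤ t) : u t < 1 := by
  have h1 : u t < u (t + 1) :=
    h.strictMonoOn hβ ht (mem_Ici.2 (by linarith)) (by linarith)
  refine h1.trans_le (ge_of_tendsto h.tendsto ?_)
  filter_upwards [eventually_ge_atTop (t + 1)] with s hs
  exact (h.strictMonoOn hβ).monotoneOn (mem_Ici.2 (by linarith)) (mem_Ici.2 (by linarith)) hs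

lemma nonneg (hβ : 0 < β) (h : IsKink β u v) {t : ℝ} (ht : 0 ≤ t) : 0 ≤ u t := by
  rcases ht.eq_or_lt with rfl | ht
  · exact h.map_zero.ge
  · exact (h.pos hβ ht).le

/-- The first-order inequality `u' > (√β / 2) (1 - u ²)`. -/
lemma lt_velocity (hβ : 0 < β) (h : IsKink β u v) {t : ℝ} (ht : 0 < t) :
    √β / 2 * (1 - u t ^ 2) < v t := by
  refine lt_of_pow_lt_pow_left₀ 2 (h.velocity_pos hβ ht).le ?_
  have := h.excess_pos ht
  rw [mul_pow, div_pow, Real.sq_sqrt hβ.le]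
  linarith

/-- The flux `e ^ (3 t) u'` decreases. -/
lemma antitoneOn_flux (hβ : 0 < β) (h : IsKink β u v) :
    AntitoneOn (fun t => Real.exp (3 * t) * v t) (Ioi 0) := by
  have hd : ∀ t, 0 < t → HasDerivAt (fun t => Real.exp (3 * t) * v t)
      (-(Real.exp (3 * t) * (β / 2 * (u t * (1 - u t ^ 2))))) t := by
    intro t ht
    have h1 : HasDerivAt (fun t : ℝ => Real.exp (3 * t)) (Real.exp (3 * t) * (3 * 1)) t :=
      ((hasDerivAt_id t).const_mul 3).exp
    exact (h1.mul (h.hasDerivAt_snd t ht)).congr_deriv (by ring)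
  refine antitoneOn_of_deriv_nonpos (convex_Ioi 0)
    (fun t ht => (hd t ht).continuousAt.continuousWithinAt)
    (fun t ht => ?_) (fun t ht => ?_) <;> rw [interior_Ioi] at ht
  · exact (hd t ht).differentiableAt.differentiableWithinAt
  · rw [(hd t ht).deriv]
    have h1 := h.pos hβ ht
    have h2 := h.lt_one hβ (le_of_lt ht)
    have : 0 < 1 - u t ^ 2 := by nlinarith
    have := Real.exp_pos (3 * t)
    rw [neg_nonpos]
    positivity

/-- In the original variable the flux is `x ^ 4 φ'`. This bound gives finite energy and controls the
boundary terms in the minimality proof. -/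
lemma flux_le_slope (hβ : 0 < β) (h : IsKink β u v) {c : ℝ}
    (hv : Tendsto v (𝓝[>] 0) (𝓝 c)) {t : ℝ} (ht : 0 < t) : Real.exp (3 * t) * v t ≤ c := by
  have h1 : Tendsto (fun t => Real.exp (3 * t) * v t) (𝓝[>] 0) (𝓝 (Real.exp (3 * 0) * c)) :=
    Tendsto.mul (((by fun_prop : Continuous fun t : ℝ => Real.exp (3 * t)).tendsto 0).mono_left
      nhdsWithin_le_nhds) hv
  have h2 : Tendsto (fun t => Real.exp (3 * t) * v t) (𝓝[>] 0) (𝓝 c) := by simpa using h1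
  refine ge_of_tendsto h2 ?_
  filter_upwards [Ioc_mem_nhdsGT ht] with s hs
  exact h.antitoneOn_flux hβ hs.1 ht hs.2

end IsKink

end MonopoleWall

namespace MonopoleWall

/-! ### Monotone iteration -/

/-- The reaction term of `(D + β + 3) (D - β) u = - reaction β u`, truncated to be monotone. -/
noncomputable def reaction (β y : ℝ) : ℝ :=
  β * (β + 3) * max 0 (min 1 y) + β / 2 * (max 0 (min 1 y) * (1 - max 0 (min 1 y) ^ 2))

/-- The bounded solution `w` of `w' = β w - reaction β f`. -/
noncomputable def innerOp (β : ℝ) (f : ℝ → ℝ) (t : ℝ) : ℝ :=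
  Real.exp (β * t) * ∫ s in Ioi t, Real.exp (-β * s) * reaction β (f s)

/-- The bounded solution `u` of `(D + β + 3) (D - β) u = - reaction β f` with `u 0 = 0`. -/
noncomputable def outerOp (β : ℝ) (f : ℝ → ℝ) (t : ℝ) : ℝ :=
  Real.exp (-(β + 3) * t) * ∫ s in (0 : ℝ)..t, Real.exp ((β + 3) * s) * innerOp β f s

variable {β : ℝ} {f g : ℝ → ℝ}

lemma continuous_reaction (β : ℝ) : Continuous (reaction β) := by
  unfold reaction
  fun_prop

lemma reaction_of_mem {y : ℝ} (h0 : 0 ≤ y) (h1 : y ≤ 1) :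
    reaction β y = β * (β + 3) * y + β / 2 * (y * (1 - y ^ 2)) := by
  simp [reaction, h0, h1]

/-- On `[0, 1]` the slope is `β (β + 3) + (β / 2) (1 - 3 y ^ 2)`, at least `β ^ 2 + 2 β`: the linear
shift outweighs the decreasing part of the cubic. -/
lemma monotone_reaction (hβ : 0 < β) : Monotone (reaction β) := by
  intro x y hxy
  have hc : max 0 (min 1 x) ≤ max 0 (min 1 y) := max_le_max le_rfl (min_le_min le_rfl hxy)
  have hx : 0 ≤ max 0 (min 1 x) := le_max_left _ _
  have hy : max 0 (min 1 y) ≤ 1 := max_le zero_le_one (min_le_left _ _)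
  unfold reaction
  generalize max 0 (min 1 x) = a at *
  generalize max 0 (min 1 y) = b at *
  have h1 : a ^ 2 + a * b + b ^ 2 ≤ 3 := by nlinarith
  have h2 : 0 ≤ (b - a) * (3 - (a ^ 2 + a * b + b ^ 2)) :=
    mul_nonneg (by linarith) (by linarith)
  have h3 : 0 ≤ β * ((b - a) * (3 - (a ^ 2 + a * b + b ^ 2))) := mul_nonneg hβ.le h2
  have h4 : 0 ≤ β * β * (b - a) := mul_nonneg (by positivity) (by linarith)
  have h5 : 0 ≤ β * (b - a) := mul_nonneg hβ.le (by linarith)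
  nlinarith

lemma reaction_nonneg (hβ : 0 < β) (y : ℝ) : 0 ≤ reaction β y := by
  have hx : 0 ≤ max 0 (min 1 y) := le_max_left _ _
  have hy : max 0 (min 1 y) ≤ 1 := max_le zero_le_one (min_le_left _ _)
  unfold reaction
  generalize max 0 (min 1 y) = a at *
  have : 0 ≤ 1 - a ^ 2 := by nlinarith
  positivity

lemma reaction_le (hβ : 0 < β) (y : ℝ) : reaction β y ≤ β * (β + 3) := by
  have h1 : reaction β 1 = β * (β + 3) := by simp [reaction]
  have h2 : reaction β (min 1 y) = reaction β y := by simp [reaction]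
  rw [← h1, ← h2]
  exact monotone_reaction hβ (min_le_left _ _)

lemma integrableOn_exp_mul_reaction (hβ : 0 < β) (hf : Measurable f) (t : ℝ) :
    IntegrableOn (fun s => Real.exp (-β * s) * reaction β (f s)) (Ioi t) := by
  refine (integrableOn_exp_mul_Ioi (neg_lt_zero.2 hβ) t).mul_bdd (c := β * (β + 3))
    ((continuous_reaction β).measurable.comp hf).aestronglyMeasurable (ae_of_all _ fun s => ?_)
  rw [Real.norm_of_nonneg (reaction_nonneg hβ _)]
  exact reaction_le hβ _

lemma innerOp_mono (hβ : 0 < β) (hf : Measurable f) (hg : Measurable g)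
    (hfg : ∀ t, 0 ≤ t → f t ≤ g t) {t : ℝ} (ht : 0 ≤ t) : innerOp β f t ≤ innerOp β g t := by
  refine mul_le_mul_of_nonneg_left (setIntegral_mono_on (integrableOn_exp_mul_reaction hβ hf t)
    (integrableOn_exp_mul_reaction hβ hg t) measurableSet_Ioi fun s hs => ?_) (Real.exp_pos _).le
  exact mul_le_mul_of_nonneg_left
    (monotone_reaction hβ (hfg s (ht.trans (le_of_lt hs)))) (Real.exp_pos _).le

lemma innerOp_congr (hfg : ∀ t, 0 ≤ t → f t = g t) {t : ℝ} (ht : 0 ≤ t) :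
    innerOp β f t = innerOp β g t := by
  unfold innerOp
  congr 1
  exact setIntegral_congr_fun measurableSet_Ioi fun s hs => by
    rw [hfg s (ht.trans (le_of_lt hs))]

lemma innerOp_nonneg (hβ : 0 < β) (t : ℝ) : 0 ≤ innerOp β f t :=
  mul_nonneg (Real.exp_pos _).le (integral_nonneg fun _ =>
    mul_nonneg (Real.exp_pos _).le (reaction_nonneg hβ _))

lemma innerOp_le (hβ : 0 < β) (hf : Measurable f) (t : ℝ) : innerOp β f t ≤ β + 3 := by
  have h1 : ∫ s in Ioi t, Real.exp (-β * s) * reaction β (f s) ≤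
      ∫ s in Ioi t, Real.exp (-β * s) * (β * (β + 3)) :=
    integral_mono (integrableOn_exp_mul_reaction hβ hf t)
      ((integrableOn_exp_mul_Ioi (neg_lt_zero.2 hβ) t).mul_const _) fun _ =>
      mul_le_mul_of_nonneg_left (reaction_le hβ _) (Real.exp_pos _).le
  rw [integral_mul_const, integral_exp_mul_Ioi (neg_lt_zero.2 hβ)] at h1
  calc innerOp β f t ≤ Real.exp (β * t) * (-Real.exp (-β * t) / -β * (β * (β + 3))) :=
        mul_le_mul_of_nonneg_left h1 (Real.exp_pos _).le
    _ = (Real.exp (β * t) * Real.exp (-β * t)) * (β + 3) := by field_simp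
    _ = β + 3 := by rw [← Real.exp_add]; simp

lemma continuous_innerOp (hβ : 0 < β) (hf : Measurable f) : Continuous (innerOp β f) := by
  have hi := integrableOn_exp_mul_reaction hβ hf
  -- The tail integral is a constant minus a primitive, which exposes its regularity in `t`.
  have heq : innerOp β f = fun t => Real.exp (β * t) *
      ((∫ s in Ioi 0, Real.exp (-β * s) * reaction β (f s)) -
        ∫ s in (0 : ℝ)..t, Real.exp (-β * s) * reaction β (f s)) := by
    funext t
    rw [innerOp, ← intervalIntegral.integral_interval_add_Ioi (hi 0) (hi t), add_sub_cancel_left]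
  have hloc : ∀ a b, IntervalIntegrable (fun s => Real.exp (-β * s) * reaction β (f s))
      volume a b := fun a b =>
    ⟨(hi a).mono_set Ioc_subset_Ioi_self, (hi b).mono_set Ioc_subset_Ioi_self⟩
  have := intervalIntegral.continuous_primitive hloc 0
  rw [heq]
  fun_prop

lemma hasDerivAt_innerOp (hβ : 0 < β) (hf : Continuous f) (t : ℝ) :
    HasDerivAt (innerOp β f) (β * innerOp β f t - reaction β (f t)) t := by
  have hi := integrableOn_exp_mul_reaction hβ hf.measurable
  have heq : innerOp β f = fun t => Real.exp (β * t) *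
      ((∫ s in Ioi 0, Real.exp (-β * s) * reaction β (f s)) -
        ∫ s in (0 : ℝ)..t, Real.exp (-β * s) * reaction β (f s)) := by
    funext t
    rw [innerOp, ← intervalIntegral.integral_interval_add_Ioi (hi 0) (hi t), add_sub_cancel_left]
  have hc : Continuous fun s => Real.exp (-β * s) * reaction β (f s) := by
    have := (continuous_reaction β).comp hf
    fun_prop
  have h1 : HasDerivAt (fun t : ℝ => Real.exp (β * t)) (Real.exp (β * t) * (β * 1)) t :=
    ((hasDerivAt_id t).const_mul β).exp
  have h2 := (hc.integral_hasStrictDerivAt 0 t).hasDerivAt.const_sub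
    (∫ s in Ioi 0, Real.exp (-β * s) * reaction β (f s))
  have h3 := h1.mul h2
  have h4 : Real.exp (β * t) * Real.exp (-β * t) = 1 := by rw [← Real.exp_add]; simp
  rw [heq]
  refine h3.congr_deriv ?_
  linear_combination (-reaction β (f t)) * h4

lemma hasDerivAt_outerOp (hβ : 0 < β) (hf : Measurable f) (t : ℝ) :
    HasDerivAt (outerOp β f) (innerOp β f t - (β + 3) * outerOp β f t) t := by
  have hc : Continuous fun s => Real.exp ((β + 3) * s) * innerOp β f s := by
    have := continuous_innerOp hβ hf
    fun_prop
  have h1 : HasDerivAt (fun t : ℝ => Real.exp (-(β + 3) * t))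
      (Real.exp (-(β + 3) * t) * (-(β + 3) * 1)) t :=
    ((hasDerivAt_id t).const_mul (-(β + 3))).exp
  have h2 := h1.mul (hc.integral_hasStrictDerivAt 0 t).hasDerivAt
  have h4 : Real.exp (-(β + 3) * t) * Real.exp ((β + 3) * t) = 1 := by
    rw [← Real.exp_add, ← add_mul]; simp
  refine h2.congr_deriv ?_
  rw [outerOp]
  linear_combination innerOp β f t * h4

lemma continuous_outerOp (hβ : 0 < β) (hf : Measurable f) : Continuous (outerOp β f) :=
  continuous_iff_continuousAt.2 fun t => (hasDerivAt_outerOp hβ hf t).continuousAt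

lemma outerOp_zero : outerOp β f 0 = 0 := by simp [outerOp]

lemma outerOp_congr (hfg : ∀ t, 0 ≤ t → f t = g t) {t : ℝ} (ht : 0 ≤ t) :
    outerOp β f t = outerOp β g t := by
  unfold outerOp
  congr 1
  refine intervalIntegral.integral_congr fun s hs => ?_
  rw [uIcc_of_le ht] at hs
  simp only [innerOp_congr hfg hs.1]

lemma outerOp_mono (hβ : 0 < β) (hf : Measurable f) (hg : Measurable g)
    (hfg : ∀ t, 0 ≤ t → f t ≤ g t) {t : ℝ} (ht : 0 ≤ t) : outerOp β f t ≤ outerOp β g t := by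
  have hcf := continuous_innerOp hβ hf
  have hcg := continuous_innerOp hβ hg
  refine mul_le_mul_of_nonneg_left (intervalIntegral.integral_mono_on ht
    (Continuous.intervalIntegrable (by fun_prop) _ _)
    (Continuous.intervalIntegrable (by fun_prop) _ _) fun s hs => ?_) (Real.exp_pos _).le
  exact mul_le_mul_of_nonneg_left (innerOp_mono hβ hf hg hfg hs.1) (Real.exp_pos _).le

/-- The inner bound `β + 3` integrates to `1 - exp (-(β + 3) t)`. Hence the constant `1` is a
supersolution from which the iteration can descend. -/
lemma outerOp_le_one (hβ : 0 < β) (hf : Measurable f) {t : ℝ} (ht : 0 ≤ t) :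
    outerOp β f t ≤ 1 := by
  have hc := continuous_innerOp hβ hf
  have hd : ∀ s, HasDerivAt (fun s => Real.exp ((β + 3) * s))
      (Real.exp ((β + 3) * s) * (β + 3)) s := fun s =>
    ((hasDerivAt_id s).const_mul (β + 3)).exp.congr_deriv (by simp)
  have h1 : ∫ s in (0 : ℝ)..t, Real.exp ((β + 3) * s) * innerOp β f s ≤
      ∫ s in (0 : ℝ)..t, Real.exp ((β + 3) * s) * (β + 3) :=
    intervalIntegral.integral_mono_on ht (Continuous.intervalIntegrable (by fun_prop) _ _)
      (Continuous.intervalIntegrable (by fun_prop) _ _) fun s _ =>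
      mul_le_mul_of_nonneg_left (innerOp_le hβ hf s) (Real.exp_pos _).le
  rw [intervalIntegral.integral_eq_sub_of_hasDerivAt (fun s _ => hd s)
    (Continuous.intervalIntegrable (by fun_prop) _ _)] at h1
  have h2 : Real.exp (-(β + 3) * t) * Real.exp ((β + 3) * t) = 1 := by
    rw [← Real.exp_add, ← add_mul]; simp
  have h3 := mul_le_mul_of_nonneg_left h1 (Real.exp_pos (-(β + 3) * t)).le
  have h4 := Real.exp_pos (-(β + 3) * t)
  simp only [mul_zero, Real.exp_zero] at h3
  unfold outerOp
  nlinarith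

/-- Comparison: a subsolution that lies below `f` lies below `outerOp β f`. -/
lemma le_outerOp (hβ : 0 < β) (hf : Measurable f) {u v v' : ℝ → ℝ}
    (hu : ∀ t, 0 < t → HasDerivAt u (v t) t) (hv : ∀ t, 0 < t → HasDerivAt v (v' t) t)
    (hsub : ∀ t, 0 < t → 0 ≤ v' t + 3 * v t + β / 2 * (u t * (1 - u t ^ 2)))
    (hcont : ContinuousOn u (Ici 0)) (h0 : u 0 = 0) (hmem : ∀ t, 0 ≤ t → u t ∈ Icc (0 : ℝ) 1)
    {C : ℝ} (hC : ∀ t, 1 ≤ t → v t ≤ C) (hle : ∀ t, 0 ≤ t → u t ≤ f t) {t : ℝ} (ht : 0 ≤ t) :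
    u t ≤ outerOp β f t := by
  -- The two factors are inverted one at a time. For `z = v + (β + 3) u` the hypothesis reads `z' -
  -- β z ≥ -reaction β u ≥ -reaction β f`, integrated from `s` to infinity with weight `exp (-β r)`.
  -- The upper bound `C` on `v` disposes of the term at infinity.
  have hz : ∀ s, 0 < s → v s + (β + 3) * u s ≤ innerOp β f s := by
    intro s hs
    have hi := integrableOn_exp_mul_reaction hβ hf s
    have hd : ∀ r, 0 < r → HasDerivAt (fun r => -(Real.exp (-β * r) * (v r + (β + 3) * u r)))
        (-(Real.exp (-β * r) * (v' r + 3 * v r - β * (β + 3) * u r))) r := by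
      intro r hr
      have h1 : HasDerivAt (fun r : ℝ => Real.exp (-β * r)) (Real.exp (-β * r) * (-β * 1)) r :=
        ((hasDerivAt_id r).const_mul (-β)).exp
      have h2 := (h1.mul ((hv r hr).add ((hu r hr).const_mul (β + 3)))).neg
      exact h2.congr_deriv (by simp only [Pi.add_apply]; ring)
    have hb : ∀ b, s ≤ b → Real.exp (-β * s) * (v s + (β + 3) * u s) -
        Real.exp (-β * b) * (v b + (β + 3) * u b) ≤
        ∫ r in s..b, Real.exp (-β * r) * reaction β (f r) := by
      intro b hb
      have := intervalIntegral.sub_le_integral_of_hasDeriv_right_of_le hb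
        (g := fun r => -(Real.exp (-β * r) * (v r + (β + 3) * u r)))
        (φ := fun r => Real.exp (-β * r) * reaction β (f r))
        (fun r hr => (hd r (hs.trans_le hr.1)).continuousAt.continuousWithinAt)
        (fun r hr => (hd r (hs.trans hr.1)).hasDerivWithinAt)
        (((integrableOn_Icc_iff_integrableOn_Ioc).2 (hi.mono_set Ioc_subset_Ioi_self)))
        (fun r hr => by
          have hr0 : 0 < r := hs.trans hr.1
          rw [← mul_neg]
          refine mul_le_mul_of_nonneg_left ?_ (Real.exp_pos _).le
          refine le_trans ?_ (monotone_reaction hβ (hle r hr0.le))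
          rw [reaction_of_mem (hmem r hr0.le).1 (hmem r hr0.le).2]
          linarith [hsub r hr0])
      linarith
    have hlim : Tendsto (fun b => (∫ r in s..b, Real.exp (-β * r) * reaction β (f r)) +
        Real.exp (-β * b) * (C + (β + 3))) atTop
        (𝓝 ((∫ r in Ioi s, Real.exp (-β * r) * reaction β (f r)) + 0 * (C + (β + 3)))) := by
      refine (intervalIntegral_tendsto_integral_Ioi s hi tendsto_id).add (Tendsto.mul_const _ ?_)
      refine Real.tendsto_exp_atBot.comp ?_
      exact tendsto_id.const_mul_atTop_of_neg (neg_lt_zero.2 hβ)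
    have h1 : Real.exp (-β * s) * (v s + (β + 3) * u s) ≤
        ∫ r in Ioi s, Real.exp (-β * r) * reaction β (f r) := by
      rw [zero_mul, add_zero] at hlim
      refine ge_of_tendsto hlim ?_
      filter_upwards [eventually_ge_atTop s, eventually_ge_atTop 1] with b hsb h1b
      have h3 : v b + (β + 3) * u b ≤ C + (β + 3) := by
        nlinarith [hC b h1b, (hmem b (hs.le.trans hsb)).2]
      have := mul_le_mul_of_nonneg_left h3 (Real.exp_pos (-β * b)).le
      linarith [hb b hsb]
    have h2 : Real.exp (β * s) * Real.exp (-β * s) = 1 := by rw [← Real.exp_add]; simp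
    calc v s + (β + 3) * u s
        = Real.exp (β * s) * (Real.exp (-β * s) * (v s + (β + 3) * u s)) := by
          rw [← mul_assoc, h2, one_mul]
      _ ≤ innerOp β f s := mul_le_mul_of_nonneg_left h1 (Real.exp_pos _).le
  have hc := continuous_innerOp hβ hf
  have hcE : Continuous fun s => Real.exp ((β + 3) * s) * innerOp β f s := by fun_prop
  -- The second factor `D + β + 3` is inverted forward from `u 0 = 0`.
  have hmain := intervalIntegral.sub_le_integral_of_hasDeriv_right_of_le ht
    (g := fun r => Real.exp ((β + 3) * r) * u r)
    (g' := fun r => Real.exp ((β + 3) * r) * (v r + (β + 3) * u r))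
    (φ := fun r => Real.exp ((β + 3) * r) * innerOp β f r)
    (by
      have := hcont.mono (Icc_subset_Ici_self : Icc 0 t ⊆ _)
      fun_prop)
    (fun r hr => by
      have h1 : HasDerivAt (fun r : ℝ => Real.exp ((β + 3) * r))
          (Real.exp ((β + 3) * r) * ((β + 3) * 1)) r :=
        ((hasDerivAt_id r).const_mul (β + 3)).exp
      exact ((h1.mul (hu r hr.1)).congr_deriv (by ring)).hasDerivWithinAt)
    (hcE.continuousOn.integrableOn_Icc)
    (fun r hr => mul_le_mul_of_nonneg_left (hz r hr.1) (Real.exp_pos _).le)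
  rw [h0, mul_zero, sub_zero] at hmain
  have h2 : Real.exp (-(β + 3) * t) * Real.exp ((β + 3) * t) = 1 := by
    rw [← Real.exp_add, ← add_mul]; simp
  calc u t = Real.exp (-(β + 3) * t) * (Real.exp ((β + 3) * t) * u t) := by
        rw [← mul_assoc, h2, one_mul]
    _ ≤ outerOp β f t := mul_le_mul_of_nonneg_left hmain (Real.exp_pos _).le

/-- The operators are continuous under pointwise convergence on `[0, ∞)`. -/
lemma tendsto_outerOp (hβ : 0 < β) {F : ℕ → ℝ → ℝ} (hF : ∀ n, Measurable (F n))
    (hlim : ∀ t, 0 ≤ t → Tendsto (fun n => F n t) atTop (𝓝 (f t)))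
    {t : ℝ} (ht : 0 ≤ t) :
    Tendsto (fun n => outerOp β (F n) t) atTop (𝓝 (outerOp β f t)) := by
  have hinner : ∀ s, 0 ≤ s →
      Tendsto (fun n => innerOp β (F n) s) atTop (𝓝 (innerOp β f s)) := by
    intro s hs
    refine Tendsto.const_mul _ (tendsto_integral_of_dominated_convergence
      (fun r => Real.exp (-β * r) * (β * (β + 3)))
      (fun n => (integrableOn_exp_mul_reaction hβ (hF n) s).aestronglyMeasurable)
      ((integrableOn_exp_mul_Ioi (neg_lt_zero.2 hβ) s).mul_const _)
      (fun n => ae_of_all _ fun r => ?_)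
      ((ae_restrict_iff' measurableSet_Ioi).2 (ae_of_all _ fun r hr => ?_)))
    · rw [Real.norm_of_nonneg (mul_nonneg (Real.exp_pos _).le (reaction_nonneg hβ _))]
      exact mul_le_mul_of_nonneg_left (reaction_le hβ _) (Real.exp_pos _).le
    · exact (((continuous_reaction β).tendsto _).comp
        (hlim r (hs.trans (le_of_lt hr)))).const_mul _
  refine Tendsto.const_mul _ (intervalIntegral.tendsto_integral_filter_of_dominated_convergence
    (fun r => Real.exp ((β + 3) * r) * (β + 3)) (Eventually.of_forall fun n => ?_)
    (Eventually.of_forall fun n => ae_of_all _ fun r _ => ?_)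
    (Continuous.intervalIntegrable (by fun_prop) _ _) (ae_of_all _ fun r hr => ?_))
  · have := continuous_innerOp hβ (hF n)
    exact Continuous.aestronglyMeasurable (by fun_prop)
  · rw [Real.norm_of_nonneg (mul_nonneg (Real.exp_pos _).le (innerOp_nonneg hβ _))]
    exact mul_le_mul_of_nonneg_left (innerOp_le hβ (hF n) _) (Real.exp_pos _).le
  · rw [uIoc_of_le ht] at hr
    exact (hinner r hr.1.le).const_mul _

end MonopoleWall

/-! ### Existence and uniqueness of the kink. -/

namespace MonopoleWall

variable {β : ℝ}

/-- The subsolution `tanh (√β t / 2)`, which saturates the first-order inequality. -/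
noncomputable def subKink (β t : ℝ) : ℝ := 1 - 2 / (Real.exp (√β * t) + 1)

noncomputable def subKinkDeriv (β t : ℝ) : ℝ :=
  2 * √β * Real.exp (√β * t) / (Real.exp (√β * t) + 1) ^ 2

lemma subKinkDeriv_eq (β t : ℝ) : subKinkDeriv β t = √β / 2 * (1 - subKink β t ^ 2) := by
  have := Real.exp_pos (√β * t)
  unfold subKinkDeriv subKink
  field_simp
  ring

lemma hasDerivAt_subKink (β t : ℝ) : HasDerivAt (subKink β) (subKinkDeriv β t) t := by
  have hpos := Real.exp_pos (√β * t)
  have h1 : HasDerivAt (fun t : ℝ => Real.exp (√β * t) + 1) (Real.exp (√β * t) * (√β * 1)) t :=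
    (((hasDerivAt_id t).const_mul (√β)).exp).add_const 1
  have h2 := ((hasDerivAt_const t (2 : ℝ)).div h1 (by positivity)).const_sub 1
  refine h2.congr_deriv ?_
  unfold subKinkDeriv
  ring

lemma hasDerivAt_subKinkDeriv (hβ : 0 < β) (t : ℝ) :
    HasDerivAt (subKinkDeriv β) (-(β / 2 * (subKink β t * (1 - subKink β t ^ 2)))) t := by
  have h1 : HasDerivAt (fun t => √β / 2 * (1 - subKink β t ^ 2))
      (√β / 2 * (-(2 * subKink β t ^ 1 * subKinkDeriv β t))) t := by
    have := (((hasDerivAt_subKink β t).fun_pow 2).const_sub 1).const_mul (√β / 2)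
    simpa using this
  have heq : subKinkDeriv β = fun t => √β / 2 * (1 - subKink β t ^ 2) :=
    funext (subKinkDeriv_eq β)
  rw [heq]
  refine h1.congr_deriv ?_
  rw [subKinkDeriv_eq]
  linear_combination (-(subKink β t * (1 - subKink β t ^ 2)) / 2) * Real.sq_sqrt hβ.le

lemma subKink_zero : subKink β 0 = 0 := by norm_num [subKink]

lemma subKink_lt_one (t : ℝ) : subKink β t < 1 := by
  have := Real.exp_pos (√β * t)
  have : 0 < 2 / (Real.exp (√β * t) + 1) := by positivity
  unfold subKink
  linarith

lemma subKink_nonneg {t : ℝ} (ht : 0 ≤ t) : 0 ≤ subKink β t := by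
  have h1 : 1 ≤ Real.exp (√β * t) := Real.one_le_exp (by positivity)
  have : 2 / (Real.exp (√β * t) + 1) ≤ 1 := (div_le_one (by positivity)).2 (by linarith)
  unfold subKink
  linarith

lemma subKinkDeriv_pos (hβ : 0 < β) (t : ℝ) : 0 < subKinkDeriv β t := by
  have := Real.exp_pos (√β * t)
  have := Real.sqrt_pos.2 hβ
  unfold subKinkDeriv
  positivity

lemma tendsto_subKink (hβ : 0 < β) : Tendsto (subKink β) atTop (𝓝 1) := by
  have h1 : Tendsto (fun t => Real.exp (√β * t) + 1) atTop atTop :=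
    tendsto_atTop_add_const_right _ _
      (Real.tendsto_exp_atTop.comp (tendsto_id.const_mul_atTop (Real.sqrt_pos.2 hβ)))
  simpa [subKink] using! (h1.const_div_atTop 2).const_sub 1

/-- The iterates of the monotone scheme, from above. -/
noncomputable def iterateFromOne (β : ℝ) : ℕ → ℝ → ℝ
  | 0 => fun _ => 1
  | n + 1 => outerOp β (iterateFromOne β n)

lemma measurable_iterateFromOne (hβ : 0 < β) : ∀ n, Measurable (iterateFromOne β n)
  | 0 => measurable_const
  | n + 1 => (continuous_outerOp hβ (measurable_iterateFromOne hβ n)).measurable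

lemma iterateFromOne_succ_le (hβ : 0 < β) (n : ℕ) {t : ℝ} (ht : 0 ≤ t) :
    iterateFromOne β (n + 1) t ≤ iterateFromOne β n t := by
  induction n generalizing t with
  | zero => exact outerOp_le_one hβ measurable_const ht
  | succ n ih =>
    exact outerOp_mono hβ (measurable_iterateFromOne hβ _) (measurable_iterateFromOne hβ _)
      (fun s hs => ih hs) ht

lemma le_iterateFromOne (hβ : 0 < β) {u v v' : ℝ → ℝ}
    (hu : ∀ t, 0 < t → HasDerivAt u (v t) t) (hv : ∀ t, 0 < t → HasDerivAt v (v' t) t)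
    (hsub : ∀ t, 0 < t → 0 ≤ v' t + 3 * v t + β / 2 * (u t * (1 - u t ^ 2)))
    (hcont : ContinuousOn u (Ici 0)) (h0 : u 0 = 0) (hmem : ∀ t, 0 ≤ t → u t ∈ Icc (0 : ℝ) 1)
    {C : ℝ} (hC : ∀ t, 1 ≤ t → v t ≤ C) (n : ℕ) {t : ℝ} (ht : 0 ≤ t) :
    u t ≤ iterateFromOne β n t := by
  induction n generalizing t with
  | zero => exact (hmem t ht).2
  | succ n ih =>
    exact le_outerOp hβ (measurable_iterateFromOne hβ n) hu hv hsub hcont h0 hmem hC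
      (fun s hs => ih hs) ht

/-- The tanh profile solves the frictionless equation, so its residual in the full equation is the
friction term `3 u' ≥ 0`. This barrier keeps the limit of the iterates from collapsing to `0`. -/
lemma subKink_le_iterateFromOne (hβ : 0 < β) (n : ℕ) {t : ℝ} (ht : 0 ≤ t) :
    subKink β t ≤ iterateFromOne β n t := by
  refine le_iterateFromOne hβ (fun t _ => hasDerivAt_subKink β t)
    (fun t _ => hasDerivAt_subKinkDeriv hβ t) (fun t _ => ?_)
    (fun t _ => (hasDerivAt_subKink β t).continuousAt.continuousWithinAt) subKink_zero
    (fun t ht => ⟨subKink_nonneg ht, (subKink_lt_one t).le⟩) (C := √β / 2) (fun t ht => ?_) n ht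
  · have := subKinkDeriv_pos hβ t
    linarith
  · rw [subKinkDeriv_eq]
    have := mul_nonneg (Real.sqrt_nonneg β) (sq_nonneg (subKink β t))
    linarith

lemma IsKink.le_iterateFromOne (hβ : 0 < β) {u v : ℝ → ℝ} (h : IsKink β u v) (n : ℕ) {t : ℝ}
    (ht : 0 ≤ t) : u t ≤ iterateFromOne β n t := by
  refine MonopoleWall.le_iterateFromOne hβ h.hasDerivAt_fst h.hasDerivAt_snd (fun t _ => ?_)
    h.continuousOn h.map_zero (fun t ht => ⟨h.nonneg hβ ht, (h.lt_one hβ ht).le⟩)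
    -- The decreasing flux gives `v t ≤ exp (3 t) v t ≤ exp 3 * v 1` for `t ≥ 1`.
    (C := Real.exp (3 * 1) * v 1) (fun t ht => ?_) n ht
  · linarith
  · have h0 : 0 < t := by linarith
    have h1 := h.antitoneOn_flux hβ (mem_Ioi.2 one_pos) h0 ht
    have h2 := h.velocity_pos hβ h0
    have h3 : 1 ≤ Real.exp (3 * t) := Real.one_le_exp (by linarith)
    dsimp only at h1
    nlinarith

/-- The largest kink, as a function that is twice differentiable on the whole line. -/
theorem exists_maximal_kink (hβ : 0 < β) : ∃ U V A : ℝ → ℝ,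
    (∀ t, HasDerivAt U (V t) t) ∧ (∀ t, HasDerivAt V (A t) t) ∧ IsKink β U V ∧
      ∀ u v : ℝ → ℝ, IsKink β u v → ∀ t, 0 ≤ t → u t ≤ U t := by
  set f : ℝ → ℝ := fun t => ⨅ n, iterateFromOne β n t with hf
  have hfm : Measurable f := Measurable.iInf (measurable_iterateFromOne hβ)
  have hanti : ∀ t, 0 ≤ t → Antitone fun n => iterateFromOne β n t := fun t ht =>
    antitone_nat_of_succ_le fun n => iterateFromOne_succ_le hβ n ht
  have hlim : ∀ t, 0 ≤ t → Tendsto (fun n => iterateFromOne β n t) atTop (𝓝 (f t)) :=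
    fun t ht => tendsto_atTop_ciInf (hanti t ht)
      ⟨subKink β t, by rintro _ ⟨n, rfl⟩; exact subKink_le_iterateFromOne hβ n ht⟩
  have hfix : ∀ t, 0 ≤ t → outerOp β f t = f t := fun t ht =>
    tendsto_nhds_unique (tendsto_outerOp hβ (measurable_iterateFromOne hβ) hlim ht)
      ((tendsto_add_atTop_iff_nat 1).2 (hlim t ht))
  have hle : ∀ t, 0 ≤ t → f t ≤ 1 := fun t ht => by
    rw [← hfix t ht]; exact outerOp_le_one hβ hfm ht
  have hge : ∀ t, 0 ≤ t → subKink β t ≤ f t := fun t ht =>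
    ge_of_tendsto' (hlim t ht) fun n => subKink_le_iterateFromOne hβ n ht
  -- The limit `f` is only known to be measurable, and the fixed point equation holds only for `t ≥
  -- 0`. One application of the operator gives continuity, a second one gives two derivatives on the
  -- whole line; neither changes the values on `[0, ∞)`.
  set G := outerOp β f
  have hG : Continuous G := continuous_outerOp hβ hfm
  have hU : ∀ t, 0 ≤ t → outerOp β G t = f t := fun t ht => by
    exact (outerOp_congr hfix ht).trans (hfix t ht)
  have hd := hasDerivAt_outerOp hβ hG.measurable
  have hd2 := fun t => (hasDerivAt_innerOp hβ hG t).sub ((hd t).const_mul (β + 3))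
  refine ⟨outerOp β G, _, _, hd, hd2, ⟨⟨fun t _ => hd t, fun t ht => (hd2 t).congr_deriv ?_⟩,
    (continuous_outerOp hβ hG.measurable).continuousOn, outerOp_zero, ?_⟩, fun u v h t ht => ?_⟩
  -- Since `0 ≤ f ≤ 1`, the truncation is inactive and the original cubic reappears.
  · rw [hU t ht.le, hfix t ht.le,
      reaction_of_mem ((subKink_nonneg ht.le).trans (hge t ht.le)) (hle t ht.le)]
    ring
  · refine tendsto_of_tendsto_of_tendsto_of_le_of_le' (tendsto_subKink hβ) tendsto_const_nhds
      ?_ ?_ <;> filter_upwards [eventually_ge_atTop 0] with t ht <;> rw [hU t ht]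
    exacts [hge t ht, hle t ht]
  · rw [hU t ht]
    exact ge_of_tendsto' (hlim t ht) fun n => h.le_iterateFromOne hβ n ht

/-- A kink that lies below another one coincides with it. -/
lemma IsKink.eqOn_of_le (hβ : 0 < β) {u v U V : ℝ → ℝ} (h : IsKink β u v) (H : IsKink β U V)
    (hle : ∀ t, 0 ≤ t → u t ≤ U t) : EqOn u U (Ici 0) := by
  -- This weighted Wronskian is nondecreasing because `u ≤ U`, and it starts from `0`. Being
  -- nonnegative, it makes `U / u` nondecreasing; the limit `1` then gives `U ≤ u`.
  set W : ℝ → ℝ := fun t => Real.exp (3 * t) * (V t * u t - v t * U t) with hW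
  have hd : ∀ t, 0 < t → HasDerivAt W
      (Real.exp (3 * t) * (β / 2 * (u t * U t * (U t ^ 2 - u t ^ 2)))) t := by
    intro t ht
    have h1 : HasDerivAt (fun t : ℝ => Real.exp (3 * t)) (Real.exp (3 * t) * (3 * 1)) t :=
      ((hasDerivAt_id t).const_mul 3).exp
    have h2 := ((H.hasDerivAt_snd t ht).mul (h.hasDerivAt_fst t ht)).sub
      ((h.hasDerivAt_snd t ht).mul (H.hasDerivAt_fst t ht))
    exact (h1.mul h2).congr_deriv (by simp only [Pi.sub_apply, Pi.mul_apply]; ring)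
  have hmono : MonotoneOn W (Ioi 0) := by
    refine monotoneOn_of_deriv_nonneg (convex_Ioi 0)
      (fun t ht => (hd t ht).continuousAt.continuousWithinAt)
      (fun t ht => ?_) (fun t ht => ?_) <;> rw [interior_Ioi] at ht
    · exact (hd t ht).differentiableAt.differentiableWithinAt
    · rw [(hd t ht).deriv]
      have h1 := h.pos hβ ht
      have h2 := H.pos hβ ht
      have h3 : 0 ≤ U t ^ 2 - u t ^ 2 := by nlinarith [hle t (le_of_lt ht)]
      positivity
  obtain ⟨c, hc⟩ := h.exists_tendsto_snd h.continuousOn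
  obtain ⟨C, hC⟩ := H.exists_tendsto_snd H.continuousOn
  have hu0 : Tendsto u (𝓝[>] 0) (𝓝 0) := by
    have := (h.continuousOn 0 self_mem_Ici).mono_left (nhdsWithin_mono _ Ioi_subset_Ici_self)
    rwa [h.map_zero] at this
  have hU0 : Tendsto U (𝓝[>] 0) (𝓝 0) := by
    have := (H.continuousOn 0 self_mem_Ici).mono_left (nhdsWithin_mono _ Ioi_subset_Ici_self)
    rwa [H.map_zero] at this
  have hW0 : Tendsto W (𝓝[>] 0) (𝓝 0) := by
    have h1 : Tendsto (fun t : ℝ => Real.exp (3 * t)) (𝓝[>] 0) (𝓝 (Real.exp (3 * 0))) :=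
      ((by fun_prop : Continuous fun t : ℝ => Real.exp (3 * t)).tendsto 0).mono_left
        nhdsWithin_le_nhds
    simpa using h1.mul ((hC.mul hu0).sub (hc.mul hU0))
  have hWnn : ∀ t, 0 < t → 0 ≤ W t := fun t ht => by
    refine le_of_tendsto hW0 ?_
    filter_upwards [Ioc_mem_nhdsGT ht] with s hs using hmono hs.1 ht hs.2
  have hratio : MonotoneOn (fun t => U t / u t) (Ioi 0) := by
    have hdq : ∀ t, 0 < t → HasDerivAt (fun t => U t / u t)
        ((V t * u t - U t * v t) / u t ^ 2) t := fun t ht =>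
      (H.hasDerivAt_fst t ht).div (h.hasDerivAt_fst t ht) (h.pos hβ ht).ne'
    refine monotoneOn_of_deriv_nonneg (convex_Ioi 0)
      (fun t ht => (hdq t ht).continuousAt.continuousWithinAt)
      (fun t ht => ?_) (fun t ht => ?_) <;> rw [interior_Ioi] at ht
    · exact (hdq t ht).differentiableAt.differentiableWithinAt
    · rw [(hdq t ht).deriv]
      have h1 := nonneg_of_mul_nonneg_right (hWnn t ht) (Real.exp_pos _)
      exact div_nonneg (by linarith) (sq_nonneg _)
  have hlim : Tendsto (fun t => U t / u t) atTop (𝓝 1) := by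
    simpa using! H.tendsto.div h.tendsto one_ne_zero
  intro t ht
  rcases (mem_Ici.1 ht).eq_or_lt with rfl | ht
  · rw [h.map_zero, H.map_zero]
  · refine le_antisymm (hle t ht.le) ((div_le_one (h.pos hβ ht)).1 (ge_of_tendsto hlim ?_))
    filter_upwards [eventually_ge_atTop t] with s hs using hratio ht (ht.trans_le hs) hs

end MonopoleWall

namespace MonopoleWall

variable {β : ℝ}

/-! ### Passing between the variables `x` and `t = log x` -/

lemma SolvesODE.isTrajectory {φ : ℝ → ℝ} (h : SolvesODE β φ) :
    IsTrajectory β (fun t => φ (Real.exp t)) (fun t => Real.exp t * deriv φ (Real.exp t)) where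
  hasDerivAt_fst t ht := by
    have h1 := (h (Real.exp t) (Real.one_lt_exp_iff.2 ht)).1.hasDerivAt
    exact (h1.comp t (Real.hasDerivAt_exp t)).congr_deriv (mul_comm _ _)
  hasDerivAt_snd t ht := by
    have h1 := (h (Real.exp t) (Real.one_lt_exp_iff.2 ht)).2
    have h2 : HasDerivAt (fun t : ℝ => Real.exp (-3 * t)) (Real.exp (-3 * t) * (-3 * 1)) t :=
      ((hasDerivAt_id t).const_mul (-3)).exp
    have h3 := h2.mul (h1.comp t (Real.hasDerivAt_exp t))
    have hE : ∀ s : ℝ, Real.exp (-3 * s) = (Real.exp s ^ 3)⁻¹ := fun s => by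
      rw [← Real.exp_nat_mul, ← Real.exp_neg]; congr 1; push_cast; ring
    refine (h3.congr_of_eventuallyEq (Eventually.of_forall fun s => ?_)).congr_deriv ?_
    · have := (Real.exp_pos s).ne'
      simp only [Pi.mul_apply, Function.comp_apply, hE]
      field_simp
    · have := (Real.exp_pos t).ne'
      simp only [Function.comp_apply, hE]
      field_simp
      ring

lemma IsBVPSolution.isKink {φ : ℝ → ℝ} (h : IsBVPSolution β φ) :
    IsKink β (fun t => φ (Real.exp t)) (fun t => Real.exp t * deriv φ (Real.exp t)) where
  toIsTrajectory := h.ode.isTrajectory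
  continuousOn := h.continuousOn.comp Real.continuous_exp.continuousOn
    fun _ ht => Real.one_le_exp ht
  map_zero := by simpa using h.boundary.1
  tendsto := h.boundary.2.comp Real.tendsto_exp_atTop

lemma IsIVPSolution.continuousOn {a : ℝ} {φ : ℝ → ℝ} (h : IsIVPSolution β a φ) :
    ContinuousOn φ (Ici 1) := by
  intro x hx
  rcases (mem_Ici.1 hx).eq_or_lt with rfl | hx
  · exact h.slope.continuousWithinAt
  · exact (h.ode x hx).1.continuousAt.continuousWithinAt

/-- The initial condition prescribes a one-sided derivative, while uniqueness of trajectories uses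
the limit of the velocity. That limit exists by the equation, and is itself the one-sided
derivative. -/
lemma IsIVPSolution.tendsto_velocity {a : ℝ} {φ : ℝ → ℝ} (h : IsIVPSolution β a φ) :
    Tendsto (fun t => Real.exp t * deriv φ (Real.exp t)) (𝓝[>] 0) (𝓝 a) := by
  have hT := h.ode.isTrajectory
  have hc : ContinuousOn (fun t => φ (Real.exp t)) (Ici 0) :=
    h.continuousOn.comp Real.continuous_exp.continuousOn fun _ ht => Real.one_le_exp ht
  obtain ⟨c, hlim⟩ := hT.exists_tendsto_snd hc
  have h1 := hT.hasDerivWithinAt_zero hc hlim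
  have h2 : HasDerivWithinAt (fun t => φ (Real.exp t)) (a * 1) (Ici 0) 0 := by
    have he : HasDerivWithinAt Real.exp 1 (Ici 0) 0 := by
      simpa using (Real.hasDerivAt_exp 0).hasDerivWithinAt (s := Ici 0)
    exact HasDerivWithinAt.comp (h₂ := φ) (s' := Ici 1) 0 (by simpa using h.slope) he
      fun _ ht => Real.one_le_exp ht
  have := (uniqueDiffOn_Ici (0 : ℝ) 0 self_mem_Ici).eq_deriv _ h1 h2
  rwa [this, mul_one] at hlim

lemma eqOn_of_eqOn_exp {φ ψ : ℝ → ℝ}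
    (h : EqOn (fun t => φ (Real.exp t)) (fun t => ψ (Real.exp t)) (Ici 0)) : EqOn φ ψ (Ici 1) := by
  intro x hx
  have := h (mem_Ici.2 (Real.log_nonneg hx))
  simpa [Real.exp_log (zero_lt_one.trans_le hx)] using this

/-- Uniqueness for the initial value problem at `x = 1`. -/
lemma IsIVPSolution.eqOn {a : ℝ} {φ ψ : ℝ → ℝ} (hφ : IsIVPSolution β a φ)
    (hψ : IsIVPSolution β a ψ) : EqOn φ ψ (Ici 1) :=
  eqOn_of_eqOn_exp (hφ.ode.isTrajectory.eqOn_Ici hψ.ode.isTrajectory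
    (hφ.continuousOn.comp Real.continuous_exp.continuousOn fun _ ht => Real.one_le_exp ht)
    (hψ.continuousOn.comp Real.continuous_exp.continuousOn fun _ ht => Real.one_le_exp ht)
    hφ.tendsto_velocity hψ.tendsto_velocity (by simp [hφ.initial, hψ.initial]))

lemma IsIVPSolution.isBVPSolution {a : ℝ} {φ : ℝ → ℝ} (h : IsIVPSolution β a φ)
    (hlim : Tendsto φ atTop (𝓝 1)) : IsBVPSolution β φ :=
  ⟨h.continuousOn, ⟨h.initial, hlim⟩, h.ode⟩

lemma hasDerivAt_comp_log {U V : ℝ → ℝ} (hU : ∀ t, HasDerivAt U (V t) t) {x : ℝ} (hx : 0 < x) :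
    HasDerivAt (fun y => U (Real.log y)) (V (Real.log x) / x) x :=
  (hU _).comp x (Real.hasDerivAt_log hx.ne')

lemma solvesODE_comp_log {U V A : ℝ → ℝ} (hU : ∀ t, HasDerivAt U (V t) t)
    (hV : ∀ t, HasDerivAt V (A t) t) (h : IsTrajectory β U V) :
    SolvesODE β fun x => U (Real.log x) := by
  intro x hx
  have hx0 : 0 < x := by linarith
  refine ⟨(hasDerivAt_comp_log hU hx0).differentiableAt, ?_⟩
  have h1 : HasDerivAt (fun y => y ^ 3 * V (Real.log y))
      (3 * x ^ 2 * V (Real.log x) + x ^ 3 * (A (Real.log x) / x)) x := by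
    refine ((hasDerivAt_pow 3 x).mul (hasDerivAt_comp_log hV hx0)).congr_deriv ?_
    norm_num
  have hA : A (Real.log x) = _ := (hV _).unique (h.hasDerivAt_snd _ (Real.log_pos hx))
  refine (h1.congr_of_eventuallyEq ?_).congr_deriv ?_
  · filter_upwards [Ioi_mem_nhds hx0] with y hy
    have hy0 : y ≠ 0 := (mem_Ioi.1 hy).ne'
    rw [(hasDerivAt_comp_log hU hy).deriv]
    field_simp
  · rw [hA]
    field_simp
    ring

namespace IsBVPSolution

variable {φ ψ : ℝ → ℝ}

lemma strictMonoOn (hβ : 0 < β) (h : IsBVPSolution β φ) : StrictMonoOn φ (Ici 1) := by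
  intro x hx y hy hxy
  have hx0 : 0 < x := zero_lt_one.trans_le hx
  have hy0 : 0 < y := zero_lt_one.trans_le hy
  have := h.isKink.strictMonoOn hβ (mem_Ici.2 (Real.log_nonneg hx))
    (mem_Ici.2 (Real.log_nonneg hy)) (Real.log_lt_log hx0 hxy)
  simpa [Real.exp_log hx0, Real.exp_log hy0] using this

lemma pos (hβ : 0 < β) (h : IsBVPSolution β φ) {x : ℝ} (hx : 1 < x) : 0 < φ x := by
  simpa [Real.exp_log (zero_lt_one.trans hx)] using h.isKink.pos hβ (Real.log_pos hx)

lemma lt_one (hβ : 0 < β) (h : IsBVPSolution β φ) {x : ℝ} (hx : 1 ≤ x) : φ x < 1 := by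
  simpa [Real.exp_log (zero_lt_one.trans_le hx)] using h.isKink.lt_one hβ (Real.log_nonneg hx)

lemma lt_mul_deriv (hβ : 0 < β) (h : IsBVPSolution β φ) {x : ℝ} (hx : 1 < x) :
    √β / 2 * (1 - φ x ^ 2) < x * deriv φ x := by
  simpa [Real.exp_log (zero_lt_one.trans hx)] using h.isKink.lt_velocity hβ (Real.log_pos hx)

lemma deriv_pos (hβ : 0 < β) (h : IsBVPSolution β φ) {x : ℝ} (hx : 1 < x) : 0 < deriv φ x := by
  have hx0 : 0 < x := zero_lt_one.trans hx
  have := h.isKink.velocity_pos hβ (Real.log_pos hx)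
  rw [Real.exp_log hx0] at this
  exact pos_of_mul_pos_right this hx0.le

lemma flux_le (hβ : 0 < β) (h : IsBVPSolution β φ) {a : ℝ} (ha : IsIVPSolution β a φ) {x : ℝ}
    (hx : 1 < x) : x ^ 4 * deriv φ x ≤ a := by
  have hx0 : 0 < x := zero_lt_one.trans hx
  have := h.isKink.flux_le_slope hβ ha.tendsto_velocity (Real.log_pos hx)
  have h3 : Real.exp (3 * Real.log x) = x ^ 3 := by
    rw [← Real.exp_log (pow_pos hx0 3), Real.log_pow]; norm_num
  rw [h3, Real.exp_log hx0] at this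
  linarith

lemma slope_pos (hβ : 0 < β) (h : IsBVPSolution β φ) {a : ℝ} (ha : IsIVPSolution β a φ) :
    0 < a :=
  (mul_pos (by norm_num) (h.deriv_pos hβ one_lt_two)).trans_le (h.flux_le hβ ha one_lt_two)

end IsBVPSolution

/-- Uniqueness for the boundary value problem determines the slope, and uniqueness for the initial
value problem gives the converse. -/
lemma IsBVPSolution.shooting {φ : ℝ → ℝ} {a₀ : ℝ} (h : IsBVPSolution β φ)
    (h₀ : IsIVPSolution β a₀ φ) (huniq : ∀ ψ, IsBVPSolution β ψ → EqOn ψ φ (Ici 1)) {a : ℝ}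
    {ψ : ℝ → ℝ} (hψ : IsIVPSolution β a ψ) : Tendsto ψ atTop (𝓝 1) ↔ a = a₀ := by
  constructor
  · intro hlim
    have heq := huniq ψ (hψ.isBVPSolution hlim)
    have h1 : HasDerivWithinAt ψ a₀ (Ici 1) 1 := h₀.slope.congr heq (heq self_mem_Ici)
    exact (uniqueDiffOn_Ici (1 : ℝ) 1 self_mem_Ici).eq_deriv _ hψ.slope h1
  · rintro rfl
    refine h.boundary.2.congr' ?_
    filter_upwards [eventually_ge_atTop 1] with x hx using h₀.eqOn hψ hx

/-! ### Asymptotics at both ends. -/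

/-- First-order Taylor expansion with quadratic remainder. -/
lemma isBigO_sub_linear {f f' : ℝ → ℝ} {x₀ f'' : ℝ} (hf : ∀ᶠ x in 𝓝 x₀, HasDerivAt f (f' x) x)
    (hf' : HasDerivAt f' f'' x₀) :
    (fun x => f x - f x₀ - f' x₀ * (x - x₀)) =O[𝓝 x₀] fun x => (x - x₀) ^ 2 := by
  obtain ⟨C, hC⟩ := hf'.isBigO_sub.bound
  obtain ⟨δ, hδ, hball⟩ := Metric.eventually_nhds_iff_ball.1 (hf.and hC)
  refine IsBigO.of_bound C ?_
  filter_upwards [Metric.ball_mem_nhds x₀ hδ] with x hx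
  have hseg : ∀ y ∈ uIcc x₀ x, y ∈ Metric.ball x₀ δ ∧ |y - x₀| ≤ |x - x₀| := fun y hy => by
    have h1 : |y - x₀| ≤ |x - x₀| := abs_sub_left_of_mem_uIcc hy
    rw [Metric.mem_ball, Real.dist_eq] at *
    exact ⟨h1.trans_lt hx, h1⟩
  have hC0 : ∀ y ∈ uIcc x₀ x, ‖f' y - f' x₀‖ ≤ C * |x - x₀| ∨ C < 0 := fun y hy => by
    rcases lt_or_ge C 0 with h | h
    · exact Or.inr h
    · exact Or.inl (((hball y (hseg y hy).1).2).trans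
        (mul_le_mul_of_nonneg_left (hseg y hy).2 h))
  rcases lt_or_ge C 0 with hneg | hnn
  · rcases eq_or_ne x x₀ with rfl | hne
    · simp
    · have h1 := (hball x hx).2
      have h2 : 0 < ‖x - x₀‖ := norm_pos_iff.2 (sub_ne_zero.2 hne)
      nlinarith [norm_nonneg (f' x - f' x₀)]
  · have key := (convex_uIcc x₀ x).norm_image_sub_le_of_norm_hasDerivWithin_le
      (f := fun y => f y - f' x₀ * y) (f' := fun y => f' y - f' x₀) (C := C * |x - x₀|)
      (fun y hy => (((hball y (hseg y hy).1).1.sub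
        ((hasDerivAt_id y).const_mul (f' x₀))).congr_deriv (by simp)).hasDerivWithinAt)
      (fun y hy => (hC0 y hy).resolve_right (not_lt.2 hnn)) left_mem_uIcc right_mem_uIcc
    calc ‖f x - f x₀ - f' x₀ * (x - x₀)‖ = ‖f x - f' x₀ * x - (f x₀ - f' x₀ * x₀)‖ := by
          congr 1; ring
      _ ≤ C * |x - x₀| * ‖x - x₀‖ := key
      _ = C * ‖(x - x₀) ^ 2‖ := by rw [norm_pow, Real.norm_eq_abs]; ring

/-- Every exponent below the decay rate of the linearization at `1` is achieved. -/
lemma IsKink.exists_exp_bound (hβ : 0 < β) {u v : ℝ → ℝ} (h : IsKink β u v) {l : ℝ} (hl3 : 3 ≤ l)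
    (hl : l * (l - 3) < β) : ∃ C T, ∀ t, T ≤ t → 1 - u t ≤ C * Real.exp (-(l * t)) := by
  have hq : Tendsto (fun t => β / 2 * (u t * (1 + u t))) atTop (𝓝 (β / 2 * (1 * (1 + 1)))) :=
    (h.tendsto.mul (h.tendsto.const_add 1)).const_mul _
  have hq' : ∀ᶠ t in atTop, l * (l - 3) ≤ β / 2 * (u t * (1 + u t)) :=
    (hq.eventually (lt_mem_nhds (by linarith))).mono fun t ht => ht.le
  obtain ⟨T, hT⟩ := eventually_atTop.1 (hq'.and (eventually_gt_atTop 0))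
  have hpos : ∀ t, T ≤ t → 0 < t := fun t ht => (hT t ht).2
  -- The aim is `Z ≤ 0`, that is `(1 - u)' ≤ -l (1 - u)`. Eventually `exp (-(l - 3) t) Z` is
  -- nondecreasing, so with `l ≥ 3` a positive value of `Z` could never decrease; but `Z < l (1 -
  -- u)`, which tends to `0`.
  set Z : ℝ → ℝ := fun t => l * (1 - u t) - v t with hZ
  have hdE : ∀ c t : ℝ, HasDerivAt (fun t : ℝ => Real.exp (c * t)) (Real.exp (c * t) * (c * 1)) t :=
    fun c t => ((hasDerivAt_id t).const_mul c).exp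
  have hdZ : ∀ t, 0 < t → HasDerivAt (fun t => Real.exp (-(l - 3) * t) * Z t)
      (Real.exp (-(l - 3) * t) *
        ((β / 2 * (u t * (1 + u t)) - l * (l - 3)) * (1 - u t))) t := by
    intro t ht
    have h2 := (((h.hasDerivAt_fst t ht).const_sub 1).const_mul l).sub (h.hasDerivAt_snd t ht)
    exact ((hdE (-(l - 3)) t).mul h2).congr_deriv (by simp only [Pi.sub_apply]; ring)
  have hmono : MonotoneOn (fun t => Real.exp (-(l - 3) * t) * Z t) (Ici T) := by
    refine monotoneOn_of_deriv_nonneg (convex_Ici T)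
      (fun t ht => (hdZ t (hpos t ht)).continuousAt.continuousWithinAt)
      (fun t ht => ?_) (fun t ht => ?_) <;> rw [interior_Ici] at ht
    · exact (hdZ t (hpos t (le_of_lt ht))).differentiableAt.differentiableWithinAt
    · rw [(hdZ t (hpos t (le_of_lt ht))).deriv]
      have h1 := (hT t (le_of_lt ht)).1
      have h2 := h.lt_one hβ (hpos t (le_of_lt ht)).le
      exact mul_nonneg (Real.exp_pos _).le (mul_nonneg (by linarith) (by linarith))
  have hZle : ∀ t, T ≤ t → Z t ≤ 0 := by
    intro t ht
    by_contra! hZt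
    have hlim : Tendsto (fun s => l * (1 - u s)) atTop (𝓝 (l * (1 - 1))) :=
      (h.tendsto.const_sub 1).const_mul l
    rw [sub_self, mul_zero] at hlim
    obtain ⟨s, hs, hts⟩ :=
      ((hlim.eventually (gt_mem_nhds hZt)).and (eventually_ge_atTop t)).exists
    have h1 := hmono ht (ht.trans hts) hts
    have h2 := h.velocity_pos hβ (hpos s (ht.trans hts))
    have h3 : Real.exp (-(l - 3) * s) ≤ Real.exp (-(l - 3) * t) :=
      Real.exp_le_exp.2 (by nlinarith)
    have h4 : Z s < Z t := by
      simp only [hZ] at hs ⊢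
      linarith
    have h5 := Real.exp_pos (-(l - 3) * s)
    dsimp only at h1
    nlinarith [mul_le_mul_of_nonneg_right h3 hZt.le]
  have hdw : ∀ t, 0 < t → HasDerivAt (fun t => Real.exp (l * t) * (1 - u t))
      (Real.exp (l * t) * Z t) t := fun t ht =>
    ((hdE l t).mul ((h.hasDerivAt_fst t ht).const_sub 1)).congr_deriv (by simp only [hZ]; ring)
  have hanti : AntitoneOn (fun t => Real.exp (l * t) * (1 - u t)) (Ici T) := by
    refine antitoneOn_of_deriv_nonpos (convex_Ici T)
      (fun t ht => (hdw t (hpos t ht)).continuousAt.continuousWithinAt)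
      (fun t ht => ?_) (fun t ht => ?_) <;> rw [interior_Ici] at ht
    · exact (hdw t (hpos t (le_of_lt ht))).differentiableAt.differentiableWithinAt
    · rw [(hdw t (hpos t (le_of_lt ht))).deriv]
      exact mul_nonpos_of_nonneg_of_nonpos (Real.exp_pos _).le (hZle t (le_of_lt ht))
  refine ⟨Real.exp (l * T) * (1 - u T), T, fun t ht => ?_⟩
  have h1 := hanti self_mem_Ici ht ht
  have h2 : Real.exp (l * t) * Real.exp (-(l * t)) = 1 := by rw [← Real.exp_add]; simp
  have h3 := mul_le_mul_of_nonneg_right h1 (Real.exp_pos (-(l * t))).le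
  calc 1 - u t = Real.exp (l * t) * (1 - u t) * Real.exp (-(l * t)) := by
        rw [mul_right_comm, h2, one_mul]
    _ ≤ _ := h3

lemma IsBVPSolution.isBigO_one_sub (hβ : 0 < β) {φ : ℝ → ℝ} (h : IsBVPSolution β φ) {ε : ℝ}
    (hε : 0 < ε) : (fun x : ℝ => 1 - φ x) =O[atTop]
      fun x : ℝ => x ^ (-((3 / 2 + √((3 / 2) ^ 2 + β)) - ε)) := by
  set r := √((3 / 2) ^ 2 + β) with hr
  have hr2 : r ^ 2 = (3 / 2) ^ 2 + β := Real.sq_sqrt (by positivity)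
  have hr0 : 3 / 2 < r := Real.lt_sqrt_of_sq_lt (by linarith)
  -- For large `ε` the exponent may fall below `3`, where the exponential bound is not available;
  -- raising it to `3 < 3 / 2 + r` only strengthens the estimate.
  set l := max (3 / 2 + r - ε) 3 with hl
  have hl3 : 3 ≤ l := le_max_right _ _
  have hlr : l < 3 / 2 + r := max_lt (by linarith) (by linarith)
  obtain ⟨C, T, hC⟩ := h.isKink.exists_exp_bound hβ hl3 (by nlinarith)
  refine IsBigO.of_bound |C| ?_
  filter_upwards [eventually_ge_atTop (Real.exp T), eventually_ge_atTop 1] with x hxT hx1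
  have hx0 : 0 < x := by linarith
  have h1 := hC (Real.log x) ((Real.le_log_iff_exp_le hx0).2 hxT)
  rw [Real.exp_log hx0] at h1
  have h2 : Real.exp (-(l * Real.log x)) ≤ x ^ (-(3 / 2 + r - ε)) := by
    rw [Real.rpow_def_of_pos hx0]
    refine Real.exp_le_exp.2 ?_
    nlinarith [Real.log_nonneg hx1, le_max_left (3 / 2 + r - ε) 3]
  rw [Real.norm_of_nonneg (by linarith [h.lt_one hβ hx1]),
    Real.norm_of_nonneg (Real.rpow_nonneg hx0.le _)]
  calc 1 - φ x ≤ C * Real.exp (-(l * Real.log x)) := h1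
    _ ≤ |C| * Real.exp (-(l * Real.log x)) :=
      mul_le_mul_of_nonneg_right (le_abs_self C) (Real.exp_pos _).le
    _ ≤ _ := mul_le_mul_of_nonneg_left h2 (abs_nonneg C)

/-! ### Admissibility, and the solution in the original variable. -/

lemma absolutelyContinuousOnInterval_of_hasDerivAt {f f' : ℝ → ℝ} {s : Set ℝ} (hs : IsOpen s)
    (hd : ∀ x ∈ s, HasDerivAt f (f' x) x) (hc : ContinuousOn f' s) {a b : ℝ}
    (hsub : uIcc a b ⊆ s) : AbsolutelyContinuousOnInterval f a b := by
  refine ContDiffOn.absolutelyContinuousOnInterval (ContDiffOn.mono ?_ hsub)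
  refine (contDiffOn_one_iff_derivWithin hs.uniqueDiffOn).2
    ⟨fun x hx => (hd x hx).differentiableAt.differentiableWithinAt, hc.congr fun x hx => ?_⟩
  rw [derivWithin_of_isOpen hs hx, (hd x hx).deriv]

lemma admissible_of_hasDerivAt {φ φ' : ℝ → ℝ} (hd : ∀ x, 0 < x → HasDerivAt φ (φ' x) x)
    (hc : ContinuousOn φ' (Ioi 0)) (hb : BoundaryConditions φ) : Admissible φ := by
  refine ⟨fun b hb => absolutelyContinuousOnInterval_of_hasDerivAt isOpen_Ioi hd hc fun x hx => ?_,
    hb⟩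
  rw [uIcc_of_le hb.le] at hx
  exact zero_lt_one.trans_le hx.1

/-- The solution of the boundary value problem, with all its properties but minimality. -/
theorem exists_isBVPSolution (hβ : 0 < β) : ∃ (φ : ℝ → ℝ) (a₀ : ℝ), IsBVPSolution β φ ∧
    (∀ ψ : ℝ → ℝ, IsBVPSolution β ψ → EqOn ψ φ (Ici 1)) ∧ IsIVPSolution β a₀ φ ∧
    ((fun x : ℝ => φ x - a₀ * (x - 1)) =O[𝓝[>] 1] fun x : ℝ => (x - 1) ^ 2) ∧ Admissible φ := by
  obtain ⟨U, V, A, hU, hV, hK, hmax⟩ := exists_maximal_kink hβ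
  set φ : ℝ → ℝ := fun x => U (Real.log x) with hφ
  have hd : ∀ x, 0 < x → HasDerivAt φ (V (Real.log x) / x) x := fun x hx =>
    hasDerivAt_comp_log hU hx
  have hbd : BoundaryConditions φ :=
    ⟨by simp [hφ, hK.map_zero], hK.tendsto.comp Real.tendsto_log_atTop⟩
  have hode : SolvesODE β φ := solvesODE_comp_log hU hV hK.toIsTrajectory
  have hbvp : IsBVPSolution β φ :=
    ⟨fun x hx => (hd x (zero_lt_one.trans_le hx)).continuousAt.continuousWithinAt, hbd, hode⟩
  have hUφ : (fun t => φ (Real.exp t)) = U := funext fun t => by simp [hφ]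
  refine ⟨φ, V 0, hbvp, fun ψ hψ => eqOn_of_eqOn_exp ?_, ⟨hbd.1, ?_, hode⟩, ?_, ?_⟩
  · rw [hUφ]
    exact hψ.isKink.eqOn_of_le hβ hK (hmax _ _ hψ.isKink)
  · simpa using (hd 1 one_pos).hasDerivWithinAt (s := Ici 1)
  · have hd1 : HasDerivAt (fun x => V (Real.log x) / x) _ 1 :=
      (hasDerivAt_comp_log hV one_pos).div (hasDerivAt_id 1) one_ne_zero
    have h1 := isBigO_sub_linear (f := φ) (f' := fun x => V (Real.log x) / x)
      (by filter_upwards [Ioi_mem_nhds one_pos] with x hx using hd x hx) hd1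
    refine (h1.mono nhdsWithin_le_nhds).congr_left fun x => ?_
    simp [hbd.1]
  · refine admissible_of_hasDerivAt hd (fun x hx => ?_) hbd
    have hx0 : x ≠ 0 := (mem_Ioi.1 hx).ne'
    exact ((hasDerivAt_comp_log hV hx).continuousAt.div continuousAt_id hx0).continuousWithinAt

end MonopoleWall

namespace MonopoleWall

variable {β : ℝ} {φ ψ : ℝ → ℝ}

/-! ### Minimality -/

/-- The energy density. -/
noncomputable def density (β : ℝ) (φ : ℝ → ℝ) (x : ℝ) : ℝ :=
  x ^ 4 * deriv φ x ^ 2 + β * x ^ 2 / 4 * (φ x ^ 2 - 1) ^ 2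

lemma energy_eq_lintegral_density (β : ℝ) (φ : ℝ → ℝ) :
    energy β φ = ∫⁻ x in Ioi (1 : ℝ), ENNReal.ofReal (density β φ x) := rfl

lemma density_nonneg (hβ : 0 < β) (φ : ℝ → ℝ) (x : ℝ) : 0 ≤ density β φ x := by
  unfold density
  positivity

lemma Admissible.continuousOn (h : Admissible φ) : ContinuousOn φ (Ici 1) := by
  intro x hx
  have h1 := (h.1 (x + 1) (by linarith [mem_Ici.1 hx])).continuousOn
  rw [uIcc_of_le (by linarith [mem_Ici.1 hx])] at h1
  refine (h1 x ⟨hx, by linarith⟩).mono_of_mem_nhdsWithin ?_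
  exact mem_nhdsWithin.2 ⟨Iio (x + 1), isOpen_Iio, by simp, fun y hy => ⟨hy.2, le_of_lt hy.1⟩⟩

lemma aestronglyMeasurable_density (h : ContinuousOn φ (Ioi 1)) :
    AEStronglyMeasurable (density β φ) (volume.restrict (Ioi 1)) := by
  have h1 := (h.aestronglyMeasurable measurableSet_Ioi (μ := volume)).aemeasurable
  have h2 := measurable_deriv φ
  refine AEMeasurable.aestronglyMeasurable ?_
  unfold density
  fun_prop

lemma integrableOn_density (hβ : 0 < β) (h : ContinuousOn φ (Ioi 1)) (hfin : energy β φ ≠ ∞) :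
    IntegrableOn (density β φ) (Ioi 1) := by
  refine ⟨aestronglyMeasurable_density h, ?_⟩
  rw [hasFiniteIntegral_iff_ofReal (ae_of_all _ (density_nonneg hβ φ))]
  exact lt_top_iff_ne_top.2 hfin

lemma energy_eq_ofReal (hβ : 0 < β) (h : IntegrableOn (density β φ) (Ioi 1)) :
    energy β φ = ENNReal.ofReal (∫ x in Ioi 1, density β φ x) :=
  (ofReal_integral_eq_lintegral_ofReal h (ae_of_all _ (density_nonneg hβ φ))).symm

namespace IsBVPSolution

lemma hasDerivAt (h : IsBVPSolution β φ) {x : ℝ} (hx : 1 < x) :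
    HasDerivAt φ (deriv φ x) x := (h.ode x hx).1.hasDerivAt

lemma continuousOn_deriv (h : IsBVPSolution β φ) : ContinuousOn (deriv φ) (Ioi 1) := by
  have h1 : ContinuousOn (fun x => x ^ 4 * deriv φ x / x ^ 4) (Ioi 1) :=
    ContinuousOn.div (fun x hx => (h.ode x hx).2.continuousAt.continuousWithinAt) (by fun_prop)
      fun x hx => pow_ne_zero _ (zero_lt_one.trans hx).ne'
  refine h1.congr fun x hx => ?_
  have : x ≠ 0 := (zero_lt_one.trans hx).ne'
  field_simp

lemma continuousOn_density (h : IsBVPSolution β φ) : ContinuousOn (density β φ) (Ioi 1) := by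
  have h1 := h.continuousOn.mono Ioi_subset_Ici_self
  have h2 := h.continuousOn_deriv
  unfold density
  fun_prop

/-- The first-order inequality bounds the potential term by the gradient term, and the flux bound
gives `x ^ 4 φ' ^ 2 ≤ a ^ 2 x ^ (-4)`. -/
lemma energy_ne_top (hβ : 0 < β) (h : IsBVPSolution β φ) {a : ℝ} (ha : IsIVPSolution β a φ) :
    energy β φ ≠ ∞ := by
  have hint : IntegrableOn (fun x : ℝ => 2 * a ^ 2 * x ^ (-4 : ℝ)) (Ioi 1) :=
    (integrableOn_Ioi_rpow_of_lt (by norm_num) one_pos).const_mul _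
  refine ne_top_of_le_ne_top hint.lintegral_lt_top.ne ?_
  refine setLIntegral_mono' measurableSet_Ioi fun x hx => ENNReal.ofReal_le_ofReal ?_
  have hx0 : 0 < x := zero_lt_one.trans hx
  have h1 : β * x ^ 2 / 4 * (φ x ^ 2 - 1) ^ 2 ≤ x ^ 4 * deriv φ x ^ 2 := by
    have h2 : 0 ≤ √β / 2 * (1 - φ x ^ 2) := by
      have := h.pos hβ hx
      have := h.lt_one hβ (le_of_lt hx)
      have : 0 ≤ 1 - φ x ^ 2 := by nlinarith
      positivity
    have h3 := pow_le_pow_left₀ h2 (h.lt_mul_deriv hβ hx).le 2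
    rw [mul_pow, div_pow, Real.sq_sqrt hβ.le] at h3
    have h4 := mul_le_mul_of_nonneg_left h3 (sq_nonneg x)
    nlinarith
  have h5 : x ^ 4 * deriv φ x ^ 2 ≤ a ^ 2 * x ^ (-4 : ℝ) := by
    have h6 := pow_le_pow_left₀ (mul_nonneg (by positivity) (h.deriv_pos hβ hx).le)
      (h.flux_le hβ ha hx) 2
    have h7 : x ^ (-4 : ℝ) = (x ^ 4)⁻¹ := by
      rw [Real.rpow_neg hx0.le]; norm_cast
    rw [h7, ← div_eq_mul_inv, le_div_iff₀ (by positivity)]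
    nlinarith
  linarith

end IsBVPSolution

/-- Cauchy–Schwarz estimate at the left end point. -/
lemma Admissible.sq_div_le (hβ : 0 < β) (hψ : Admissible ψ)
    (hint : IntegrableOn (density β ψ) (Ioi 1)) {x : ℝ} (hx : 1 < x) :
    ψ x ^ 2 / (x - 1) ≤ ∫ y in (1 : ℝ)..x, density β ψ y := by
  have hx0 : 0 < x - 1 := by linarith
  have hac := hψ.1 x hx
  -- With `c` the mean slope, `2 c ψ' - c ^ 2 ≤ ψ' ^ 2` integrates to the Cauchy–Schwarz bound; the
  -- weight `y ^ 4 ≥ 1` is dropped.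
  set c := ψ x / (x - 1) with hc
  have h1 : ∫ y in (1 : ℝ)..x, (2 * c * deriv ψ y - c ^ 2) = ψ x ^ 2 / (x - 1) := by
    rw [intervalIntegral.integral_sub (hac.intervalIntegrable_deriv.const_mul _)
      intervalIntegrable_const, intervalIntegral.integral_const_mul, hac.integral_deriv_eq_sub,
      hψ.2.1, intervalIntegral.integral_const, smul_eq_mul, hc]
    field_simp
    ring
  rw [← h1]
  refine intervalIntegral.integral_mono_on hx.le
    ((hac.intervalIntegrable_deriv.const_mul _).sub intervalIntegrable_const)
    ((intervalIntegrable_iff_integrableOn_Ioc_of_le hx.le).2 (hint.mono_set Ioc_subset_Ioi_self))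
    fun y hy => ?_
  have h2 : 1 ≤ y ^ 4 := one_le_pow₀ hy.1
  have h3 : 0 ≤ β * y ^ 2 / 4 * (ψ y ^ 2 - 1) ^ 2 := by positivity
  unfold density
  nlinarith [sq_nonneg (deriv ψ y - c), sq_nonneg (deriv ψ y)]

/-- This compensates the factor `1 / φ`, of order `1 / (x - 1)`, in `piconeFlux` at the left end
point. -/
lemma Admissible.tendsto_sq_div (hβ : 0 < β) (hψ : Admissible ψ)
    (hint : IntegrableOn (density β ψ) (Ioi 1)) :
    Tendsto (fun x => ψ x ^ 2 / (x - 1)) (𝓝[>] 1) (𝓝 0) := by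
  have hii : IntervalIntegrable (density β ψ) volume 1 2 :=
    (intervalIntegrable_iff_integrableOn_Ioc_of_le one_le_two).2
      (hint.mono_set Ioc_subset_Ioi_self)
  have hcont := intervalIntegral.continuousOn_primitive_interval'
    hii (left_mem_uIcc : (1 : ℝ) ∈ uIcc 1 2)
  have hlim : Tendsto (fun x => ∫ y in (1 : ℝ)..x, density β ψ y) (𝓝[>] 1) (𝓝 0) := by
    have h1 := hcont 1 left_mem_uIcc
    rw [ContinuousWithinAt, intervalIntegral.integral_same, uIcc_of_le one_le_two] at h1
    exact h1.mono_left (nhdsWithin_le_of_mem (Icc_mem_nhdsGT one_lt_two))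
  refine tendsto_of_tendsto_of_tendsto_of_le_of_le' tendsto_const_nhds hlim ?_ ?_ <;>
    filter_upwards [self_mem_nhdsWithin] with x hx
  · exact div_nonneg (sq_nonneg _) (sub_nonneg.2 (le_of_lt hx))
  · exact hψ.sq_div_le hβ hint hx

/-- The boundary term of the Picone-type identity. -/
noncomputable def piconeFlux (φ ψ : ℝ → ℝ) (x : ℝ) : ℝ :=
  x ^ 4 * deriv φ x / φ x * ψ x ^ 2 - x ^ 4 * deriv φ x * φ x

namespace IsBVPSolution

lemma hasDerivAt_flux_div (hβ : 0 < β) (h : IsBVPSolution β φ) {x : ℝ} (hx : 1 < x) :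
    HasDerivAt (fun x => x ^ 4 * deriv φ x / φ x)
      ((β * x ^ 2 / 2 * (φ x * (φ x ^ 2 - 1)) * φ x - x ^ 4 * deriv φ x * deriv φ x) / φ x ^ 2) x :=
  (h.ode x hx).2.div (h.hasDerivAt hx) (h.pos hβ hx).ne'

lemma absolutelyContinuous_piconeFlux (hβ : 0 < β) (h : IsBVPSolution β φ) (hψ : Admissible ψ)
    {δ R : ℝ} (hδ : 1 < δ) (hR : δ ≤ R) :
    AbsolutelyContinuousOnInterval (piconeFlux φ ψ) δ R := by
  have hsub : uIcc δ R ⊆ Ioi 1 := by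
    rw [uIcc_of_le hR]; exact fun x hx => hδ.trans_le hx.1
  have hc := h.continuousOn.mono Ioi_subset_Ici_self
  have hc' := h.continuousOn_deriv
  have h1 := absolutelyContinuousOnInterval_of_hasDerivAt isOpen_Ioi
    (fun x hx => h.hasDerivAt_flux_div hβ hx)
    (ContinuousOn.div (by fun_prop) (by fun_prop) fun x hx => pow_ne_zero _ (h.pos hβ hx).ne') hsub
  have h2 := absolutelyContinuousOnInterval_of_hasDerivAt isOpen_Ioi
    (fun x hx => h.hasDerivAt hx) hc' hsub
  have h3 := absolutelyContinuousOnInterval_of_hasDerivAt isOpen_Ioi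
    (fun x hx => (h.ode x hx).2) (by fun_prop) hsub
  have h4 : AbsolutelyContinuousOnInterval ψ δ R := by
    refine (hψ.1 R (hδ.trans_le hR)).mono ?_
    rw [uIcc_of_le hR, uIcc_of_le (hδ.le.trans hR)]
    exact Icc_subset_Icc_left hδ.le
  have h5 := (h1.mul (h4.mul h4)).sub (h3.mul h2)
  convert! h5 using 1
  funext x
  simp only [piconeFlux, Pi.sub_apply, Pi.mul_apply]
  ring

/-- Picone-type inequality for the energy densities. -/
lemma picone_le (hβ : 0 < β) (h : IsBVPSolution β φ) {x : ℝ} (hx : 1 < x)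
    (hd : DifferentiableAt ℝ ψ x) :
    density β φ x + β * x ^ 2 / 4 * (φ x ^ 2 - ψ x ^ 2) ^ 2 + deriv (piconeFlux φ ψ) x ≤
      density β ψ x := by
  have h1 := ((h.hasDerivAt_flux_div hβ hx).mul (hd.hasDerivAt.fun_pow 2)).sub
    ((h.ode x hx).2.mul (h.hasDerivAt hx))
  have h2 : HasDerivAt (piconeFlux φ ψ) _ x := h1
  have hφ := (h.pos hβ hx).ne'
  -- The exact identity: the gradient terms leave the Picone square, and the quartic potential
  -- leaves `(φ ^ 2 - ψ ^ 2) ^ 2`.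
  have h3 : density β φ x + β * x ^ 2 / 4 * (φ x ^ 2 - ψ x ^ 2) ^ 2 + deriv (piconeFlux φ ψ) x +
      x ^ 4 * (deriv ψ x - deriv φ x * ψ x / φ x) ^ 2 = density β ψ x := by
    rw [h2.deriv]
    unfold density
    field_simp
    push_cast
    ring
  have h4 : 0 ≤ x ^ 4 * (deriv ψ x - deriv φ x * ψ x / φ x) ^ 2 := by positivity
  linarith

lemma integral_picone_le (hβ : 0 < β) (h : IsBVPSolution β φ) (hψ : Admissible ψ)
    (hint : IntegrableOn (density β ψ) (Ioi 1)) {δ R : ℝ} (hδ : 1 < δ) (hR : δ ≤ R) :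
    (∫ x in δ..R, density β φ x + β * x ^ 2 / 4 * (φ x ^ 2 - ψ x ^ 2) ^ 2) +
      (piconeFlux φ ψ R - piconeFlux φ ψ δ) ≤ ∫ x in Ioi 1, density β ψ x := by
  have hac := h.absolutelyContinuous_piconeFlux hβ hψ hδ hR
  have hsub : Icc δ R ⊆ Ioi 1 := fun x hx => hδ.trans_le hx.1
  have hc : ContinuousOn (fun x => density β φ x + β * x ^ 2 / 4 * (φ x ^ 2 - ψ x ^ 2) ^ 2)
      (uIcc δ R) := by
    rw [uIcc_of_le hR]
    have h1 := h.continuousOn_density.mono hsub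
    have h2 := (h.continuousOn.mono Ioi_subset_Ici_self).mono hsub
    have h3 := (hψ.continuousOn.mono Ioi_subset_Ici_self).mono hsub
    fun_prop
  have hdiff : ∀ᵐ x, x ∈ Icc δ R → DifferentiableAt ℝ ψ x := by
    filter_upwards [(hψ.1 R (hδ.trans_le hR)).ae_differentiableAt] with x hx hxm
    refine hx ?_
    rw [uIcc_of_le (hδ.le.trans hR)]
    exact ⟨hδ.le.trans hxm.1, hxm.2⟩
  have hii : IntervalIntegrable (density β ψ) volume δ R :=
    (intervalIntegrable_iff_integrableOn_Ioc_of_le hR).2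
      (hint.mono_set (Ioc_subset_Icc_self.trans hsub))
  rw [← hac.integral_deriv_eq_sub,
    ← intervalIntegral.integral_add hc.intervalIntegrable hac.intervalIntegrable_deriv]
  refine (intervalIntegral.integral_mono_ae_restrict hR
    (hc.intervalIntegrable.add hac.intervalIntegrable_deriv) hii ?_).trans ?_
  · refine (ae_restrict_iff' measurableSet_Icc).2 ?_
    filter_upwards [hdiff] with x hx hxm using h.picone_le hβ (hsub hxm) (hx hxm)
  · rw [intervalIntegral.integral_of_le hR]
    exact setIntegral_mono_set hint (ae_of_all _ (density_nonneg hβ ψ))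
      (Ioc_subset_Icc_self.trans hsub).eventuallyLE

/-- Minimality of the solution, with a remainder. -/
theorem lintegral_le_energy (hβ : 0 < β) (h : IsBVPSolution β φ) {a : ℝ}
    (ha : IsIVPSolution β a φ) (hψ : Admissible ψ) :
    ∫⁻ x in Ioi (1 : ℝ), ENNReal.ofReal
      (density β φ x + β * x ^ 2 / 4 * (φ x ^ 2 - ψ x ^ 2) ^ 2) ≤ energy β ψ := by
  rcases eq_or_ne (energy β ψ) ∞ with htop | hfin
  · rw [htop]; exact le_top
  have hφc := h.continuousOn.mono Ioi_subset_Ici_self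
  have hψc := hψ.continuousOn.mono Ioi_subset_Ici_self
  have hint := integrableOn_density hβ hψc hfin
  set q : ℝ → ℝ := fun x => density β φ x + β * x ^ 2 / 4 * (φ x ^ 2 - ψ x ^ 2) ^ 2 with hq
  have hqc : ContinuousOn q (Ioi 1) := by
    have := h.continuousOn_density
    fun_prop
  have hq0 : ∀ x, 0 ≤ q x := fun x => by
    have := density_nonneg hβ φ x
    simp only [hq]
    positivity
  -- The half-line is exhausted by intervals away from `1`, where `φ` vanishes and `piconeFlux` is
  -- singular.
  set δ : ℕ → ℝ := fun n => 1 + 1 / ((n : ℝ) + 1) with hδ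
  set R : ℕ → ℝ := fun n => 2 + (n : ℝ) with hR
  have hδ1 : ∀ n, 1 < δ n := fun n => by
    have : 0 < 1 / ((n : ℝ) + 1) := by positivity
    simp only [hδ]; linarith
  have hδR : ∀ n, δ n ≤ R n := fun n => by
    have : 1 / ((n : ℝ) + 1) ≤ 1 := by
      rw [div_le_one (by positivity)]; linarith [(Nat.cast_nonneg n : (0 : ℝ) ≤ n)]
    simp only [hδ, hR]; linarith [(Nat.cast_nonneg n : (0 : ℝ) ≤ n)]
  have hδlim : Tendsto δ atTop (𝓝 1) := by
    simpa only [add_zero] using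
      (tendsto_one_div_add_atTop_nhds_zero_nat (𝕜 := ℝ)).const_add (1 : ℝ)
  have hδlim' : Tendsto δ atTop (𝓝[>] 1) :=
    tendsto_nhdsWithin_iff.2 ⟨hδlim, Eventually.of_forall hδ1⟩
  have hRlim : Tendsto R atTop atTop := tendsto_atTop_add_const_left _ _ tendsto_natCast_atTop_atTop
  have hcover : AECover (volume.restrict (Ioi (1 : ℝ))) atTop fun n => Ioc (δ n) (R n) := by
    refine ⟨(ae_restrict_iff' measurableSet_Ioi).2 (ae_of_all _ fun x hx => ?_),
      fun n => measurableSet_Ioc⟩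
    filter_upwards [hδlim.eventually (gt_mem_nhds hx), hRlim.eventually (eventually_ge_atTop x)]
      with n h1 h2 using ⟨h1, h2⟩
  have hlim := hcover.lintegral_tendsto_of_countably_generated
    (f := fun x => ENNReal.ofReal (q x))
    (hqc.aestronglyMeasurable measurableSet_Ioi).aemeasurable.ennreal_ofReal
  have hpieces : ∀ n, ∫⁻ x in Ioc (δ n) (R n), ENNReal.ofReal (q x) ∂(volume.restrict (Ioi 1)) =
      ENNReal.ofReal (∫ x in (δ n)..(R n), q x) := fun n => by
    have hsub : Icc (δ n) (R n) ⊆ Ioi 1 := fun x hx => (hδ1 n).trans_le hx.1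
    rw [Measure.restrict_restrict measurableSet_Ioc,
      inter_eq_left.2 (Ioc_subset_Icc_self.trans hsub), intervalIntegral.integral_of_le (hδR n),
      ofReal_integral_eq_lintegral_ofReal _ (ae_of_all _ hq0)]
    exact ((hqc.mono hsub).integrableOn_Icc).mono_set Ioc_subset_Icc_self
  -- The last two terms majorize the boundary contributions at `δ n` and `R n` by means of `0 < x ^
  -- 4 φ' ≤ a`.
  set c : ℕ → ℝ := fun n => (∫ x in Ioi 1, density β ψ x) +
    (a * (ψ (δ n) ^ 2 / φ (δ n)) + a * (|ψ (R n) ^ 2 - φ (R n) ^ 2| / φ (R n))) with hc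
  have ha0 : 0 < a := h.slope_pos hβ ha
  have hbound : ∀ n, ∫ x in (δ n)..(R n), q x ≤ c n := fun n => by
    have hR1 : 1 < R n := (hδ1 n).trans_le (hδR n)
    have h1 := h.integral_picone_le hβ hψ hint (hδ1 n) (hδR n)
    have h2 : piconeFlux φ ψ (δ n) ≤ a * (ψ (δ n) ^ 2 / φ (δ n)) := by
      have hp := h.pos hβ (hδ1 n)
      have hd := h.deriv_pos hβ (hδ1 n)
      have hle := h.flux_le hβ ha (hδ1 n)
      have h3 : 0 ≤ δ n ^ 4 * deriv φ (δ n) * φ (δ n) := by positivity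
      have h4 := mul_le_mul_of_nonneg_right hle
        (by positivity : 0 ≤ ψ (δ n) ^ 2 / φ (δ n))
      unfold piconeFlux
      calc _ ≤ δ n ^ 4 * deriv φ (δ n) / φ (δ n) * ψ (δ n) ^ 2 := by linarith
        _ = δ n ^ 4 * deriv φ (δ n) * (ψ (δ n) ^ 2 / φ (δ n)) := by ring
        _ ≤ _ := h4
    have h5 : -piconeFlux φ ψ (R n) ≤ a * (|ψ (R n) ^ 2 - φ (R n) ^ 2| / φ (R n)) := by
      have hp := h.pos hβ hR1
      have hd := h.deriv_pos hβ hR1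
      have hle := h.flux_le hβ ha hR1
      have h6 := mul_le_mul_of_nonneg_right hle
        (by positivity : 0 ≤ |ψ (R n) ^ 2 - φ (R n) ^ 2| / φ (R n))
      have h7 : -piconeFlux φ ψ (R n) =
          R n ^ 4 * deriv φ (R n) * (-(ψ (R n) ^ 2 - φ (R n) ^ 2) / φ (R n)) := by
        unfold piconeFlux
        field_simp
      rw [h7]
      refine le_trans (mul_le_mul_of_nonneg_left ?_ (by positivity)) h6
      gcongr
      exact neg_le_abs _
    simp only [hc]
    linarith
  have hclim : Tendsto c atTop (𝓝 (∫ x in Ioi 1, density β ψ x)) := by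
    have hslope : Tendsto (fun x => φ x / (x - 1)) (𝓝[>] 1) (𝓝 a) := by
      refine ((hasDerivWithinAt_iff_tendsto_slope' (lt_irrefl (1 : ℝ))).1
        ha.slope.Ioi_of_Ici).congr fun x => ?_
      rw [slope_def_field, ha.initial, sub_zero]
    have h1 : Tendsto (fun x => ψ x ^ 2 / φ x) (𝓝[>] 1) (𝓝 0) := by
      have h2 := (hψ.tendsto_sq_div hβ hint).div hslope ha0.ne'
      rw [zero_div] at h2
      refine h2.congr' ?_
      filter_upwards [self_mem_nhdsWithin] with x hx
      have h3 : x - 1 ≠ 0 := (sub_pos.2 hx).ne'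
      have h4 := (h.pos hβ hx).ne'
      simp only [Pi.div_apply]
      field_simp
    have h2 : Tendsto (fun x => |ψ x ^ 2 - φ x ^ 2| / φ x) atTop (𝓝 0) := by
      simpa using! (((hψ.2.2.pow 2).sub (h.boundary.2.pow 2)).abs).div h.boundary.2 one_ne_zero
    simpa using! (((h1.comp hδlim').const_mul a).add ((h2.comp hRlim).const_mul a)).const_add
      (∫ x in Ioi 1, density β ψ x)
  rw [energy_eq_ofReal hβ hint]
  refine le_of_tendsto_of_tendsto' hlim (ENNReal.tendsto_ofReal hclim) fun n => ?_
  rw [hpieces n]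
  exact ENNReal.ofReal_le_ofReal (hbound n)

theorem energy_le (hβ : 0 < β) (h : IsBVPSolution β φ) {a : ℝ}
    (ha : IsIVPSolution β a φ) (hψ : Admissible ψ) : energy β φ ≤ energy β ψ := by
  refine le_trans (lintegral_mono fun x => ENNReal.ofReal_le_ofReal ?_)
    (h.lintegral_le_energy hβ ha hψ)
  exact le_add_of_nonneg_right (by positivity)

/-- The minimizer is unique up to sign. -/
theorem sq_eq_sq_of_energy_le (hβ : 0 < β) (h : IsBVPSolution β φ) {a : ℝ}
    (ha : IsIVPSolution β a φ) (hψ : Admissible ψ) (hle : energy β ψ ≤ energy β φ) {x : ℝ}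
    (hx : 1 < x) : φ x ^ 2 = ψ x ^ 2 := by
  have hφc := h.continuousOn.mono Ioi_subset_Ici_self
  have hψc := hψ.continuousOn.mono Ioi_subset_Ici_self
  set p : ℝ → ℝ := fun x => β * x ^ 2 / 4 * (φ x ^ 2 - ψ x ^ 2) ^ 2 with hp
  have hpc : ContinuousOn p (Ioi 1) := by fun_prop
  have hp0 : ∀ x, 0 ≤ p x := fun x => by simp only [hp]; positivity
  have hpm : AEMeasurable (fun x => ENNReal.ofReal (p x)) (volume.restrict (Ioi 1)) :=
    (hpc.aestronglyMeasurable measurableSet_Ioi).aemeasurable.ennreal_ofReal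
  have h1 := (h.lintegral_le_energy hβ ha hψ).trans hle
  rw [lintegral_congr fun x => ENNReal.ofReal_add (density_nonneg hβ φ x) (hp0 x), lintegral_add_right' _ hpm, energy_eq_lintegral_density] at h1
  -- The energy of `φ` is finite, so it can be cancelled and the remainder has zero integral.
  have h2 : ∫⁻ x in Ioi (1 : ℝ), ENNReal.ofReal (p x) = 0 := by
    by_contra hne
    exact (ENNReal.lt_add_right (h.energy_ne_top hβ ha) hne).not_ge h1
  rw [lintegral_eq_zero_iff' hpm] at h2
  have h3 : p =ᵐ[volume.restrict (Ioi 1)] fun _ => 0 := by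
    filter_upwards [h2] with y hy
    exact le_antisymm (ENNReal.ofReal_eq_zero.1 hy) (hp0 y)
  have h4 := Measure.eqOn_open_of_ae_eq h3 isOpen_Ioi hpc continuousOn_const hx
  have h5 : 0 < β * x ^ 2 / 4 := by have : 0 < x := zero_lt_one.trans hx; positivity
  have h6 := (mul_eq_zero.1 h4).resolve_left h5.ne'
  exact sub_eq_zero.1 (pow_eq_zero_iff two_ne_zero |>.1 h6)

theorem minEnergy_eq (hβ : 0 < β) (h : IsBVPSolution β φ) {a : ℝ} (ha : IsIVPSolution β a φ)
    (hadm : Admissible φ) : minEnergy β = (energy β φ).toReal := by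
  unfold minEnergy
  congr 1
  exact le_antisymm (iInf₂_le φ hadm) (le_iInf₂ fun ψ hψ => h.energy_le hβ ha hψ)

end IsBVPSolution

end MonopoleWall

namespace MonopoleWall

variable {β : ℝ} {φ ψ : ℝ → ℝ}

/-! ### Bounds for the minimum energy -/

lemma setIntegral_Ioi_lt_of_lt {f g : ℝ → ℝ} {a : ℝ} (hf : IntegrableOn f (Ioi a))
    (hg : IntegrableOn g (Ioi a)) (hlt : ∀ x, a < x → f x < g x) :
    ∫ x in Ioi a, f x < ∫ x in Ioi a, g x := by
  rw [← sub_pos, ← integral_sub hg hf]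
  refine (setIntegral_pos_iff_support_of_nonneg_ae ?_ (hg.sub hf)).2 ?_
  · exact (ae_restrict_iff' measurableSet_Ioi).2
      (ae_of_all _ fun x hx => (sub_pos.2 (hlt x hx)).le)
  · have : Function.support (g - f) ∩ Ioi a = Ioi a :=
      inter_eq_right.2 fun x hx => (sub_pos.2 (hlt x hx)).ne'
    rw [this, Real.volume_Ioi]
    exact ENNReal.zero_lt_top

/-- Completing the square bounds the density below by `x ^ 3 √β φ' (1 - φ ^ 2)`. Since `x ^ 3 > 1`,
this exceeds the derivative of `√β (φ - φ ^ 3 / 3)`, whose total increase is `2 √β / 3`. -/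
theorem IsBVPSolution.lt_integral_density (hβ : 0 < β) (h : IsBVPSolution β φ) {a : ℝ}
    (ha : IsIVPSolution β a φ) : 2 * √β / 3 < ∫ x in Ioi 1, density β φ x := by
  have hd : ∀ x ∈ Ioi (1 : ℝ), HasDerivAt (fun x => √β * (φ x - φ x ^ 3 / 3))
      (√β * (deriv φ x * (1 - φ x ^ 2))) x := fun x hx => by
    have h1 := h.hasDerivAt hx
    refine ((h1.sub ((h1.fun_pow 3).div_const 3)).const_mul (√β)).congr_deriv ?_
    push_cast
    ring
  have hlim : Tendsto (fun x => √β * (φ x - φ x ^ 3 / 3)) atTop (𝓝 (√β * (1 - 1 ^ 3 / 3))) :=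
    (h.boundary.2.sub ((h.boundary.2.pow 3).div_const 3)).const_mul _
  have hcont : ContinuousWithinAt (fun x => √β * (φ x - φ x ^ 3 / 3)) (Ici 1) 1 := by
    have := h.continuousOn 1 self_mem_Ici
    fun_prop
  have hfac : ∀ x, 1 < x → 0 < deriv φ x * (1 - φ x ^ 2) := fun x hx => by
    have h1 := h.pos hβ hx
    have h2 := h.lt_one hβ hx.le
    exact mul_pos (h.deriv_pos hβ hx) (by nlinarith)
  have hint := integrableOn_Ioi_deriv_of_nonneg hcont hd
    (fun x hx => mul_nonneg (Real.sqrt_nonneg _) (hfac x hx).le) hlim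
  have hval := integral_Ioi_of_hasDerivAt_of_tendsto hcont hd hint hlim
  rw [h.boundary.1] at hval
  calc 2 * √β / 3 = ∫ x in Ioi 1, √β * (deriv φ x * (1 - φ x ^ 2)) := by rw [hval]; ring
    _ < _ := setIntegral_Ioi_lt_of_lt hint (integrableOn_density hβ
      (h.continuousOn.mono Ioi_subset_Ici_self) (h.energy_ne_top hβ ha)) fun x hx => ?_
  have hb := Real.sqrt_pos.2 hβ
  have h1 : 1 < x ^ 3 := one_lt_pow₀ hx (by norm_num)
  have h2 := mul_lt_mul_of_pos_right h1 (mul_pos hb (hfac x hx))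
  have h3 : density β φ x - x ^ 3 * (√β * (deriv φ x * (1 - φ x ^ 2))) =
      (x ^ 2 * deriv φ x - √β / 2 * x * (1 - φ x ^ 2)) ^ 2 := by
    unfold density
    linear_combination (-(x ^ 2 * (1 - φ x ^ 2) ^ 2 / 4)) * Real.sq_sqrt hβ.le
  nlinarith [sq_nonneg (x ^ 2 * deriv φ x - √β / 2 * x * (1 - φ x ^ 2))]

/-! ### The test function, `sigma` and the upper bound. -/

/-- The test function `tanh ((√β / 2) log x)`. -/
noncomputable def testProfile (β x : ℝ) : ℝ := subKink β (Real.log x)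

lemma testProfile_eq {x : ℝ} (hx : 0 < x) : testProfile β x = 1 - 2 / (x ^ √β + 1) := by
  rw [testProfile, subKink, Real.rpow_def_of_pos hx, mul_comm]

lemma hasDerivAt_testProfile {x : ℝ} (hx : 0 < x) :
    HasDerivAt (testProfile β) (√β / 2 * (1 - testProfile β x ^ 2) / x) x := by
  rw [testProfile, ← subKinkDeriv_eq]
  exact hasDerivAt_comp_log (hasDerivAt_subKink β) hx

lemma admissible_testProfile (hβ : 0 < β) : Admissible (testProfile β) := by
  refine admissible_of_hasDerivAt (fun x hx => hasDerivAt_testProfile hx) (fun x hx => ?_)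
    ⟨by simp [testProfile, subKink_zero], (tendsto_subKink hβ).comp Real.tendsto_log_atTop⟩
  have h1 := (hasDerivAt_testProfile (β := β) hx).continuousAt
  have h2 : x ≠ 0 := (mem_Ioi.1 hx).ne'
  exact ((continuousAt_const.mul (continuousAt_const.sub (h1.pow 2))).div continuousAt_id
    h2).continuousWithinAt

lemma testProfile_nonneg {x : ℝ} (hx : 1 ≤ x) : 0 ≤ testProfile β x :=
  subKink_nonneg (Real.log_nonneg hx)

lemma density_testProfile (hβ : 0 < β) {x : ℝ} (hx : 0 < x) :
    density β (testProfile β) x = 8 * β * x ^ 2 * ((x ^ √β) ^ 2 / (x ^ √β + 1) ^ 4) := by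
  rw [density, (hasDerivAt_testProfile hx).deriv, testProfile_eq hx]
  have hy := Real.rpow_pos_of_pos hx (√β)
  field_simp
  rw [Real.sq_sqrt hβ.le]
  ring

lemma three_halves_lt_sqrt (hβ : 9 / 4 < β) : 3 / 2 < √β :=
  Real.lt_sqrt_of_sq_lt (by norm_num; exact hβ)

lemma rpow_two_sub {x b : ℝ} (hx : 0 < x) : x ^ (2 - 2 * b) = x ^ 2 / (x ^ b) ^ 2 := by
  rw [Real.rpow_sub hx, mul_comm, Real.rpow_mul hx.le]
  norm_cast

lemma integrableOn_of_le_rpow {f : ℝ → ℝ} {C p : ℝ} (hp : p < -1) (hc : ContinuousOn f (Ioi 1))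
    (h0 : ∀ x, 1 < x → 0 ≤ f x) (hle : ∀ x, 1 < x → f x ≤ C * x ^ p) :
    IntegrableOn f (Ioi 1) := by
  refine Integrable.mono' ((integrableOn_Ioi_rpow_of_lt hp one_pos).const_mul C)
    (hc.aestronglyMeasurable measurableSet_Ioi)
    ((ae_restrict_iff' measurableSet_Ioi).2 (ae_of_all _ fun x hx => ?_))
  rw [Real.norm_of_nonneg (h0 x hx)]
  exact hle x hx

lemma continuousOn_rpow_const_Ioi_one (b : ℝ) : ContinuousOn (fun x : ℝ => x ^ b) (Ioi 1) :=
  fun _ hx => (Real.continuousAt_rpow_const _ _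
    (Or.inl (zero_lt_one.trans hx).ne')).continuousWithinAt

/-- The density decays like `x ^ (2 - 2 √β)`, which is integrable exactly when `√β > 3 / 2`. -/
lemma integrableOn_density_testProfile (hβ : 9 / 4 < β) :
    IntegrableOn (density β (testProfile β)) (Ioi 1) := by
  have hβ0 : 0 < β := by linarith
  have hb := three_halves_lt_sqrt hβ
  have hc := continuousOn_rpow_const_Ioi_one √β
  have hpos : ∀ x : ℝ, 1 < x → 0 < x ^ √β := fun x hx =>
    Real.rpow_pos_of_pos (zero_lt_one.trans hx) _
  refine IntegrableOn.congr_fun (f := fun x => 8 * β * x ^ 2 * ((x ^ √β) ^ 2 / (x ^ √β + 1) ^ 4))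
    ?_ (fun x hx => (density_testProfile hβ0 (zero_lt_one.trans hx)).symm) measurableSet_Ioi
  refine integrableOn_of_le_rpow (C := 8 * β) (p := 2 - 2 * √β) (by linarith)
    (ContinuousOn.mul (by fun_prop) (ContinuousOn.div (by fun_prop) (by fun_prop) fun x hx => ?_))
    (fun x hx => by positivity) fun x hx => ?_
  · have := hpos x hx; positivity
  · rw [rpow_two_sub (zero_lt_one.trans hx), mul_assoc]
    have hy := hpos x hx
    refine mul_le_mul_of_nonneg_left ?_ (by positivity)
    rw [div_eq_mul_one_div (x ^ 2)]
    refine mul_le_mul_of_nonneg_left ?_ (by positivity)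
    rw [div_le_div_iff₀ (by positivity) (by positivity)]
    generalize x ^ √β = y at *
    nlinarith [pow_pos hy 2, pow_pos hy 3]

/-- The integrand of `sigma`. -/
noncomputable def sigmaDensity (β y : ℝ) : ℝ :=
  y ^ (3 / √β - 1) * ((3 * y + 1) / (y + 1) ^ 3)

lemma sigma_eq (β : ℝ) : sigma β = 4 * ∫ y in Ioi (1 : ℝ), sigmaDensity β y := rfl

lemma rpow_sub_one_eq {y : ℝ} (hy : 0 < y) (s : ℝ) : y ^ (s - 1) = y ^ (s - 3) * y ^ 2 := by
  rw [← Real.rpow_natCast, ← Real.rpow_add hy]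
  congr 1
  push_cast
  ring

/-- The factor `y ^ 2 (3 y + 1) / (y + 1) ^ 3` increases from `1 / 2` at `1` to `3` at infinity;
these are the constants in this bound and the next. -/
lemma sigmaDensity_lt {y : ℝ} (hy : 1 < y) : sigmaDensity β y < 3 * y ^ (3 / √β - 3) := by
  have hy0 : 0 < y := by linarith
  have hp := Real.rpow_pos_of_pos hy0 (3 / √β - 3)
  have h1 : y ^ 2 * ((3 * y + 1) / (y + 1) ^ 3) < 3 := by
    rw [← mul_div_assoc, div_lt_iff₀ (by positivity)]
    nlinarith
  rw [sigmaDensity, rpow_sub_one_eq hy0, mul_assoc, mul_comm 3 (y ^ _)]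
  exact mul_lt_mul_of_pos_left h1 hp

lemma lt_sigmaDensity {y : ℝ} (hy : 1 < y) : 1 / 2 * y ^ (3 / √β - 3) < sigmaDensity β y := by
  have hy0 : 0 < y := by linarith
  have hp := Real.rpow_pos_of_pos hy0 (3 / √β - 3)
  have h1 : 1 / 2 < y ^ 2 * ((3 * y + 1) / (y + 1) ^ 3) := by
    rw [← mul_div_assoc, div_lt_div_iff₀ (by positivity) (by positivity)]
    nlinarith [mul_pos (sub_pos.2 hy) (sub_pos.2 hy), mul_pos hy0 (sub_pos.2 hy),
      mul_pos (mul_pos hy0 hy0) (sub_pos.2 hy)]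
  rw [sigmaDensity, rpow_sub_one_eq hy0, mul_assoc, mul_comm (1 / 2) (y ^ _)]
  exact mul_lt_mul_of_pos_left h1 hp

lemma three_div_sqrt_sub_lt (hβ : 9 / 4 < β) : 3 / √β - 3 < -1 := by
  have hb := three_halves_lt_sqrt hβ
  have : 3 / √β < 2 := (div_lt_iff₀ (by linarith)).2 (by linarith)
  linarith

lemma integrableOn_sigmaDensity (hβ : 9 / 4 < β) : IntegrableOn (sigmaDensity β) (Ioi 1) := by
  have hc := continuousOn_rpow_const_Ioi_one (3 / √β - 1)
  refine integrableOn_of_le_rpow (three_div_sqrt_sub_lt hβ) (hc.mul (ContinuousOn.div (by fun_prop)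
    (by fun_prop) fun y hy => ?_)) (fun y hy => ?_) fun y hy => (sigmaDensity_lt hy).le
  · have : 0 < y := zero_lt_one.trans hy
    positivity
  · have : 0 < y := zero_lt_one.trans hy
    unfold sigmaDensity
    positivity

theorem sigma_bounds (hβ : 9 / 4 < β) :
    1 + 3 / (2 * √β - 3) < sigma β ∧ sigma β < 6 + 18 / (2 * √β - 3) := by
  have hb := three_halves_lt_sqrt hβ
  have hp := three_div_sqrt_sub_lt hβ
  have hi := integrableOn_Ioi_rpow_of_lt hp one_pos
  have h1 := setIntegral_Ioi_lt_of_lt (hi.const_mul (1 / 2)) (integrableOn_sigmaDensity hβ)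
    fun y hy => lt_sigmaDensity hy
  have h2 := setIntegral_Ioi_lt_of_lt (integrableOn_sigmaDensity hβ) (hi.const_mul 3)
    fun y hy => sigmaDensity_lt hy
  rw [integral_const_mul, integral_Ioi_rpow_of_lt hp one_pos, Real.one_rpow] at h1 h2
  -- The integral of the comparison power; the factors `4 * (1 / 2)` and `4 * 3` then give both
  -- bounds.
  have h3 : -1 / (3 / √β - 3 + 1) = √β / (2 * √β - 3) := by
    have h4 : √β ≠ 0 := by linarith
    have h5 : 2 * √β - 3 ≠ 0 := by linarith
    have h6 : 3 / √β - 3 + 1 ≠ 0 := by linarith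
    rw [div_eq_div_iff h6 h5]
    field_simp
    ring
  have h5 : 2 * √β - 3 ≠ 0 := by linarith
  have h7 : 1 + 3 / (2 * √β - 3) = 2 * (√β / (2 * √β - 3)) := by field_simp; ring
  have h8 : 6 + 18 / (2 * √β - 3) = 12 * (√β / (2 * √β - 3)) := by field_simp; ring
  rw [h3] at h1 h2
  rw [sigma_eq, h7, h8]
  constructor <;> linarith

/-- `sigma` in the variable `x = y ^ (1 / √β)`. -/
lemma sigma_eq_integral_comp (hβ : 9 / 4 < β) :
    IntegrableOn (fun x => 4 * √β * x ^ 2 * ((3 * x ^ √β + 1) / (x ^ √β + 1) ^ 3)) (Ioi 1) ∧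
    ∫ x in Ioi (1 : ℝ), 4 * √β * x ^ 2 * ((3 * x ^ √β + 1) / (x ^ √β + 1) ^ 3) = sigma β := by
  have hb := three_halves_lt_sqrt hβ
  have hb0 : 0 < √β := by linarith
  have hpos : ∀ x : ℝ, 1 < x → 0 < x ^ √β := fun x hx =>
    Real.rpow_pos_of_pos (zero_lt_one.trans hx) _
  constructor
  · have hc := continuousOn_rpow_const_Ioi_one √β
    refine integrableOn_of_le_rpow (C := 12 * √β) (p := 2 - 2 * √β) (by linarith)
      (ContinuousOn.mul (by fun_prop) (ContinuousOn.div (by fun_prop) (by fun_prop)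
        fun x hx => ?_)) (fun x hx => ?_) fun x hx => ?_
    · have := hpos x hx; positivity
    · have := hpos x hx; positivity
    · rw [rpow_two_sub (zero_lt_one.trans hx)]
      have hy := hpos x hx
      have h1 : (3 * x ^ √β + 1) / (x ^ √β + 1) ^ 3 ≤ 3 / (x ^ √β) ^ 2 := by
        rw [div_le_div_iff₀ (by positivity) (by positivity)]
        generalize x ^ √β = y at *
        nlinarith [pow_pos hy 2, pow_pos hy 3]
      calc _ ≤ 4 * √β * x ^ 2 * (3 / (x ^ √β) ^ 2) :=
            mul_le_mul_of_nonneg_left h1 (by positivity)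
        _ = _ := by ring
  · have h1 := integral_comp_rpow_Ioi_of_pos' (g := sigmaDensity β) hb0 zero_le_one
    rw [Real.one_rpow] at h1
    rw [sigma_eq, ← h1, ← integral_const_mul]
    refine setIntegral_congr_fun measurableSet_Ioi fun x hx => ?_
    have hx0 : 0 < x := zero_lt_one.trans hx
    have h2 : x ^ (√β - 1) * (x ^ √β) ^ (3 / √β - 1) = x ^ 2 := by
      rw [← Real.rpow_mul hx0.le, ← Real.rpow_add hx0, ← Real.rpow_natCast]
      congr 1
      field_simp
      push_cast
      ring
    simp only [sigmaDensity, smul_eq_mul]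
    linear_combination (-4 * √β * ((3 * x ^ √β + 1) / (x ^ √β + 1) ^ 3)) * h2

theorem integral_density_testProfile (hβ : 9 / 4 < β) :
    ∫ x in Ioi 1, density β (testProfile β) x = sigma β + 2 * √β / 3 := by
  have hβ0 : 0 < β := by linarith
  have hb := three_halves_lt_sqrt hβ
  have hb0 : 0 < √β := by linarith
  obtain ⟨hSi, hS⟩ := sigma_eq_integral_comp hβ
  have hLi := integrableOn_density_testProfile hβ
  set S : ℝ → ℝ := fun x => 4 * √β * x ^ 2 * ((3 * x ^ √β + 1) / (x ^ √β + 1) ^ 3) with hSdef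
  -- Integration by parts: the profile makes the completed square vanish, so its density is `√β x ^
  -- 3 T' (1 - T ^ 2)`. The bracket is the integral of `1 - s ^ 2` from `T` to `1`. Differentiating
  -- `x ^ 3` produces the integrand `S` of `sigma`, and `H 1 = -2 √β / 3`.
  set H : ℝ → ℝ := fun x =>
    -(√β * x ^ 3) * (2 / 3 - testProfile β x + testProfile β x ^ 3 / 3) with hH
  have hHeq : ∀ x, 0 < x →
      H x = -(√β * x ^ 3) * (4 * (3 * x ^ √β + 1) / (3 * (x ^ √β + 1) ^ 3)) := fun x hx => by
    have := Real.rpow_pos_of_pos hx √β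
    simp only [hH, testProfile_eq hx]
    field_simp
    ring
  have hd : ∀ x ∈ Ici (1 : ℝ), HasDerivAt H (density β (testProfile β) x - S x) x := by
    intro x hx
    have hx0 : 0 < x := zero_lt_one.trans_le hx
    have hT := hasDerivAt_testProfile (β := β) hx0
    have h1 := (((hasDerivAt_pow 3 x).const_mul (√β)).neg).mul
      ((hT.const_sub (2 / 3)).add ((hT.fun_pow 3).div_const 3))
    refine h1.congr_deriv ?_
    rw [density_testProfile hβ0 hx0]
    simp only [hSdef, testProfile_eq hx0, Pi.add_apply, Pi.neg_apply]
    have := Real.rpow_pos_of_pos hx0 √β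
    have hsq : β = √β ^ 2 := (Real.sq_sqrt hβ0.le).symm
    generalize √β = b at *
    subst hsq
    generalize x ^ b = y at *
    push_cast
    field_simp
    ring
  have hlim : Tendsto H atTop (𝓝 0) := by
    have h1 : Tendsto (fun x : ℝ => 4 * √β * x ^ (-(2 * √β - 3))) atTop (𝓝 (4 * √β * 0)) :=
      (tendsto_rpow_neg_atTop (by linarith)).const_mul _
    rw [mul_zero] at h1
    refine squeeze_zero_norm' ?_ h1
    filter_upwards [eventually_gt_atTop 0] with x hx
    have hy := Real.rpow_pos_of_pos hx √β
    have h2 : x ^ (-(2 * √β - 3)) = x ^ 3 / (x ^ √β) ^ 2 := by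
      rw [neg_sub, Real.rpow_sub hx, mul_comm, Real.rpow_mul hx.le]
      norm_cast
    have h3 : 4 * (3 * x ^ √β + 1) / (3 * (x ^ √β + 1) ^ 3) ≤ 4 / (x ^ √β) ^ 2 := by
      rw [div_le_div_iff₀ (by positivity) (by positivity)]
      generalize x ^ √β = y at *
      nlinarith [pow_pos hy 2, pow_pos hy 3]
    rw [hHeq x hx, h2, norm_mul, norm_neg, Real.norm_of_nonneg (by positivity),
      Real.norm_of_nonneg (by positivity)]
    calc _ ≤ √β * x ^ 3 * (4 / (x ^ √β) ^ 2) := mul_le_mul_of_nonneg_left h3 (by positivity)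
      _ = _ := by ring
  have h1 := integral_Ioi_of_hasDerivAt_of_tendsto' hd (hLi.sub hSi) hlim
  rw [integral_sub hLi hSi, hS, hHeq 1 one_pos, Real.one_rpow] at h1
  linarith

/-- Were the test profile also a minimizer, it would coincide with `φ`; but it satisfies with
equality the first-order inequality that is strict for `φ`. -/
theorem IsBVPSolution.integral_density_lt (hβ : 9 / 4 < β) (h : IsBVPSolution β φ) {a : ℝ}
    (ha : IsIVPSolution β a φ) : ∫ x in Ioi 1, density β φ x < sigma β + 2 * √β / 3 := by
  have hβ0 : 0 < β := by linarith
  have hφi := integrableOn_density hβ0 (h.continuousOn.mono Ioi_subset_Ici_self)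
    (h.energy_ne_top hβ0 ha)
  rw [← integral_density_testProfile hβ]
  by_contra! hle
  have hle' : energy β (testProfile β) ≤ energy β φ := by
    rw [energy_eq_ofReal hβ0 hφi, energy_eq_ofReal hβ0 (integrableOn_density_testProfile hβ)]
    exact ENNReal.ofReal_le_ofReal hle
  have heq : ∀ x, 1 < x → φ x = testProfile β x := fun x hx =>
    (pow_left_inj₀ (h.pos hβ0 hx).le (testProfile_nonneg hx.le) two_ne_zero).1
      (h.sq_eq_sq_of_energy_le hβ0 ha (admissible_testProfile hβ0) hle' hx)
  have hd : deriv φ 2 = √β / 2 * (1 - testProfile β 2 ^ 2) / 2 := by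
    rw [← (hasDerivAt_testProfile two_pos).deriv]
    refine Filter.EventuallyEq.deriv_eq ?_
    filter_upwards [Ioi_mem_nhds one_lt_two] with x hx using heq x hx
  have h1 := h.lt_mul_deriv hβ0 one_lt_two
  rw [hd, heq 2 one_lt_two] at h1
  linarith

theorem minEnergy_bounds (hβ : 9 / 4 < β) :
    2 * √β / 3 < minEnergy β ∧ minEnergy β < sigma β + 2 * √β / 3 := by
  have hβ0 : 0 < β := by linarith
  obtain ⟨φ, a, h, -, ha, -, hadm⟩ := exists_isBVPSolution hβ0
  have hφi := integrableOn_density hβ0 (h.continuousOn.mono Ioi_subset_Ici_self)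
    (h.energy_ne_top hβ0 ha)
  rw [h.minEnergy_eq hβ0 ha hadm, energy_eq_ofReal hβ0 hφi,
    ENNReal.toReal_ofReal (integral_nonneg (density_nonneg hβ0 φ))]
  exact ⟨h.lt_integral_density hβ0 ha, h.integral_density_lt hβ ha⟩

theorem isEquivalent_minEnergy : minEnergy ~[atTop] (fun β : ℝ => 2 * √β / 3) := by
  have hlim : Tendsto (fun β : ℝ => 2 * √β / 3) atTop atTop :=
    (Real.tendsto_sqrt_atTop.const_mul_atTop two_pos).atTop_div_const three_pos
  have hO : (minEnergy - fun β : ℝ => 2 * √β / 3) =O[atTop] fun _ => (1 : ℝ) := by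
    -- For `β > 4` one has `2 √β - 3 > 1`, hence `sigma β < 6 + 18`.
    refine IsBigO.of_bound 24 ?_
    filter_upwards [eventually_gt_atTop 4] with β hβ
    obtain ⟨h1, h2⟩ := minEnergy_bounds (β := β) (by linarith)
    have h3 := (sigma_bounds (β := β) (by linarith)).2
    have h4 : 2 < √β := Real.lt_sqrt_of_sq_lt (by linarith)
    have h5 : 18 / (2 * √β - 3) ≤ 18 := div_le_self (by norm_num) (by linarith)
    rw [Pi.sub_apply, Real.norm_of_nonneg (by linarith), norm_one]
    linarith
  exact hO.trans_isLittleO ((isLittleO_const_left).2 (Or.inr (tendsto_norm_atTop_atTop.comp hlim)))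

end MonopoleWall

open MonopoleWall in
theorem theorem2p1 :
    (∀ β : ℝ, 0 < β →
      ∃ φ : ℝ → ℝ,
        -- existence and uniqueness for the boundary value problem
        IsBVPSolution β φ ∧
        (∀ ψ : ℝ → ℝ, IsBVPSolution β ψ → EqOn ψ φ (Ici 1)) ∧
        -- monotonicity and range
        StrictMonoOn φ (Ici 1) ∧
        (∀ x : ℝ, 1 < x → 0 < φ x ∧ φ x < 1) ∧
        -- the initial slope: shooting characterization and expansion at the left end point
        (∃ a₀ : ℝ, 0 < a₀ ∧
          IsIVPSolution β a₀ φ ∧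
          (∀ (a : ℝ) (ψ : ℝ → ℝ), IsIVPSolution β a ψ →
            (Tendsto ψ atTop (𝓝 1) ↔ a = a₀)) ∧
          (fun x : ℝ => φ x - a₀ * (x - 1)) =O[𝓝[>] 1] (fun x : ℝ => (x - 1) ^ 2)) ∧
        -- decay at infinity
        (∀ ε : ℝ, 0 < ε →
          (fun x : ℝ => 1 - φ x) =O[atTop]
            (fun x : ℝ => x ^ (-((3 / 2 + √((3 / 2) ^ 2 + β)) - ε)))) ∧
        -- energy minimization
        Admissible φ ∧ energy β φ ≠ ∞ ∧
        (∀ ψ : ℝ → ℝ, Admissible ψ → energy β φ ≤ energy β ψ) ∧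
        minEnergy β = (energy β φ).toReal) ∧
    -- bounds for the minimum energy
    (∀ β : ℝ, 9 / 4 < β →
      2 * √β / 3 < minEnergy β ∧ minEnergy β < sigma β + 2 * √β / 3 ∧
      1 + 3 / (2 * √β - 3) < sigma β ∧ sigma β < 6 + 18 / (2 * √β - 3)) ∧
    minEnergy ~[atTop] (fun β : ℝ => 2 * √β / 3) := by
  refine ⟨fun β hβ => ?_, fun β hβ => ?_, isEquivalent_minEnergy⟩
  · obtain ⟨φ, a₀, h, huniq, ha, hO, hadm⟩ := exists_isBVPSolution hβ
    exact ⟨φ, h, huniq, h.strictMonoOn hβ, fun x hx => ⟨h.pos hβ hx, h.lt_one hβ hx.le⟩,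
      ⟨a₀, h.slope_pos hβ ha, ha, fun a ψ hψ => h.shooting ha huniq hψ, hO⟩,
      fun ε hε => h.isBigO_one_sub hβ hε, hadm, h.energy_ne_top hβ ha,
      fun ψ hψ => h.energy_le hβ ha hψ, h.minEnergy_eq hβ ha hadm⟩
  · exact ⟨(minEnergy_bounds hβ).1, (minEnergy_bounds hβ).2, sigma_bounds hβ⟩
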